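/- **Definitions.** Let $F$ be a finite set of binary features; an example is a map $e : F \to \{0,1\}$. A *term* is a finite set of literals $(f=z)$ with $f \in F$, $z \in \{0,1\}$; it *applies* to $e$ if $e(f)=z$ for each of its literals; its size is its number of literals. A *decision set* is a pair $(T,b)$ of a finite set $T$ of terms and a class $b\in\{0,1\}$; it classifies $e$ as $b$ if no term of $T$ applies to $e$, and as $1-b$ otherwise. A *decision list* is a non-empty finite sequence of rules $(t_1,c_1),\dots,(t_\ell,c_\ell)$, each a term and a class, with $t_\ell=\emptyset$; it classifies $e$ as the class of the first rule whose term applies to $e$. An *ensemble* is a finite collection $\mathcal E$ of such models over the same features (copies allowed); it classifies $e$ as $b$ if at least $\lfloor|\mathcal E|/2\rfloor+1$ of its members do. If neither class has such a majority (a tie), one of three conventions is fixed: $e$ is classified as $0$, $e$ is classified as $1$, or $e$ is left unclassified. A *local contrastive explanation* for an example $e$ with respect to a model $M$ is a set $A \subseteq F$ such that some example $e'$ that agrees with $e$ outside $A$ satisfies $M(e') \neq M(e)$, where $M(e)$ and $M(e')$ are both required to be defined. For a model type $\mathcal M$, the problem $\mathcal M$-lCXp$_{\mathrm{card}}$ asks,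 given $M\in\mathcal M$, an example $e$ and an integer $k\ge 0$, whether there is a local contrastive explanation for $e$ with respect to $M$ of size at most $k$. Let *term_size* be the size of a largest term that occurs in $M$ ($0$ if there is none), and *xp_size* the number $k$. A problem with parameter $\kappa$ is *fixed-parameter tractable* if there are an algorithm, a computable function $f$ and a constant $c$ such that the algorithm decides every instance $x$ in at most $f(\kappa(x))\cdot n^{c}$ steps, where $n$ is the size of the encoding of $x$. **Theorem.** Let $\mathcal M$ be the class of decision sets or the class of decision lists. Then $\mathcal M$-lCXp$_{\mathrm{card}}$, parameterized by $\textit{term\_size}+\textit{xp\_size}$, is fixed-parameter tractable. Moreover, for every constant $s$ and each of the three conventions for ties, the problem lCXp$_{\mathrm{card}}$ for ensembles of at most $s$ models from $\mathcal M$, parameterized by $\textit{term\_size}+\textit{xp\_size}$, is fixed-parameter tractable. -/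

import Mathlib

/-!
## A machine model with a step count

Data are binary trees without labels: the empty tree `nil` and pairs. Programs are the
variable-free form of the language WHILE on binary trees (as in textbook complexity theory on
Lisp-like data): every primitive operation, every pairing, composition, test and loop iteration
costs one step, on top of the cost of its parts. Every step builds at most one new cell (trees are
shared through pointers), there is no primitive that compares trees, and a Turing machine step is
a bounded number of steps, so the model is polynomially equivalent to Turing machines.
-/

/-- Data: unlabelled binary trees, i.e. `nil` and pairs. -/
abbrev Data : Type := BinaryTree Unit

/-- The pair of two data. -/
abbrev Data.pair (a b : Data) : Data := BinaryTree.node () a b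

/-- The size of a datum: the number of its pairs. -/
abbrev Data.size (d : Data) : ℕ := BinaryTree.numNodes d

/-- Programs. A program computes a partial function from data to data. -/
inductive Prog : Type
  | id : Prog
  | nil : Prog
  | hd : Prog
  | tl : Prog
  | pair (p q : Prog) : Prog
  | comp (q p : Prog) : Prog
  | cond (b p q : Prog) : Prog
  | loop (b p : Prog) : Prog

/-- `p.Runs x y t`: on input `x`, the program `p` halts with output `y` after exactly `t` steps.
A test succeeds if its value is not `nil`; the head and the tail of `nil` are `nil`. -/
inductive Prog.Runs : Prog → Data → Data → ℕ → Prop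
  | id (x : Data) : Runs .id x x 1
  | nil (x : Data) : Runs .nil x BinaryTree.nil 1
  | hd (a b : Data) : Runs .hd (Data.pair a b) a 1
  | hd_nil : Runs .hd BinaryTree.nil BinaryTree.nil 1
  | tl (a b : Data) : Runs .tl (Data.pair a b) b 1
  | tl_nil : Runs .tl BinaryTree.nil BinaryTree.nil 1
  | pair {p q : Prog} {x y z : Data} {s t : ℕ} :
      Runs p x y s → Runs q x z t → Runs (.pair p q) x (Data.pair y z) (s + t + 1)
  | comp {p q : Prog} {x y z : Data} {s t : ℕ} :
      Runs p x y s → Runs q y z t → Runs (.comp q p) x z (s + t + 1)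
  | cond_true {b p q : Prog} {x u y : Data} {s t : ℕ} :
      Runs b x u s → u ≠ BinaryTree.nil → Runs p x y t → Runs (.cond b p q) x y (s + t + 1)
  | cond_false {b p q : Prog} {x y : Data} {s t : ℕ} :
      Runs b x BinaryTree.nil s → Runs q x y t → Runs (.cond b p q) x y (s + t + 1)
  | loop_stop {b p : Prog} {x : Data} {s : ℕ} :
      Runs b x BinaryTree.nil s → Runs (.loop b p) x x (s + 1)
  | loop_step {b p : Prog} {x u y z : Data} {r s t : ℕ} :
      Runs b x u r → u ≠ BinaryTree.nil → Runs p x y s → Runs (.loop b p) y z t →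
        Runs (.loop b p) x z (r + s + t + 1)

/-! ## Fixed-parameter tractability -/

/-- A parameterized decision problem: instances with their encoding as data, the parameter of an
instance, and the set of yes-instances. -/
structure ParamProblem where
  Instance : Type
  encode : Instance → Data
  param : Instance → ℕ
  Yes : Instance → Prop

/-- A parameterized problem is fixed-parameter tractable if one program decides every instance
`x` in at most `f (param x) * n ^ c` steps, where `n` is the size of the encoded instance,
`f` is a computable function and `c` is a constant. The program accepts with any output but
`nil`. -/
def ParamProblem.IsFPT (Q : ParamProblem) : Prop :=
  ∃ (p : Prog) (f : ℕ → ℕ) (c : ℕ), Computable f ∧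
    ∀ x : Q.Instance, ∃ (y : Data) (t : ℕ), p.Runs (Q.encode x) y t ∧
      t ≤ f (Q.param x) * (Q.encode x).size ^ c ∧ (y ≠ BinaryTree.nil ↔ Q.Yes x)

/-! ## Encodings -/

def encodeBool : Bool → Data
  | false => BinaryTree.nil
  | true => Data.pair BinaryTree.nil BinaryTree.nil

def encodeList {α : Type} (enc : α → Data) : List α → Data
  | [] => BinaryTree.nil
  | a :: l => Data.pair (enc a) (encodeList enc l)

/-- Natural numbers are written in binary, least significant bit first. -/
def encodeNat (n : ℕ) : Data := encodeList encodeBool n.bits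

/-! ## Examples, decision sets, decision lists

Finite sets (of literals, of terms) are presented by lists of their elements, as in the input of
an algorithm. Classification depends only on membership. -/

/-- An example over the set `F` of binary features. -/
abbrev Example (F : Type) : Type := F → Bool

/-- The literal `(f, z)` stands for `f = z`. -/
abbrev Literal (F : Type) : Type := F × Bool

/-- A term is a set of literals. -/
abbrev Term (F : Type) : Type := List (Literal F)

/-- A term applies to an example if the example satisfies all its literals. -/
def Term.Applies {F : Type} (t : Term F) (e : Example F) : Prop := ∀ l ∈ t, e l.1 = l.2

instance {F : Type} (t : Term F) (e : Example F) : Decidable (t.Applies e) :=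
  inferInstanceAs (Decidable (∀ l ∈ t, e l.1 = l.2))

/-- The largest number of literals of a term in a list of terms (`0` if there is none). -/
def maxTermSize {F : Type} (ts : List (Term F)) : ℕ := (ts.map List.length).foldr max 0

/-- A decision set: a set of terms and a default class. -/
structure DecisionSet (F : Type) where
  terms : List (Term F)
  default : Bool

/-- The default class if no term applies, and the other class otherwise. -/
def DecisionSet.classify {F : Type} (S : DecisionSet F) (e : Example F) : Bool :=
  if ∃ t ∈ S.terms, t.Applies e then !S.default else S.default

/-- A decision list: a non-empty sequence of rules (a term and a class), the last of which has
the empty term. -/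
structure DecisionList (F : Type) where
  rules : List (Term F × Bool)
  last_empty : ∃ c : Bool, rules.getLast? = some ([], c)

/-- The class of the first rule that applies (the last rule applies to every example, so the
value for a failed search is never used). -/
def DecisionList.classify {F : Type} (L : DecisionList F) (e : Example F) : Bool :=
  ((L.rules.find? fun r => decide (r.1.Applies e)).map Prod.snd).getD false

/-! ## Model types and ensembles -/

/-- A type of models: for each number `n` of features, the models over the features `Fin n`, their
encoding, their classification of examples (`none`: the example is left unclassified, which can
happen for ensembles only) and the size of their largest term. -/
structure ModelType where
  Model : ℕ → Type
  encode : {n : ℕ} → Model n → Data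
  classify : {n : ℕ} → Model n → Example (Fin n) → Option Bool
  termSize : {n : ℕ} → Model n → ℕ

def encodeLiteral {n : ℕ} (l : Literal (Fin n)) : Data :=
  Data.pair (encodeNat l.1.val) (encodeBool l.2)

def encodeTerm {n : ℕ} (t : Term (Fin n)) : Data := encodeList encodeLiteral t

/-- Decision sets as a type of models. -/
def decisionSets : ModelType where
  Model n := DecisionSet (Fin n)
  encode S := Data.pair (encodeList encodeTerm S.terms) (encodeBool S.default)
  classify S e := some (S.classify e)
  termSize S := maxTermSize S.terms

/-- Decision lists as a type of models. -/
def decisionLists : ModelType where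
  Model n := DecisionList (Fin n)
  encode L := encodeList (fun r => Data.pair (encodeTerm r.1) (encodeBool r.2)) L.rules
  classify L e := some (L.classify e)
  termSize L := maxTermSize (L.rules.map Prod.fst)

/-- The number of members of an ensemble that classify `e` as `b`. -/
def ModelType.votes (𝓜 : ModelType) {n : ℕ} (E : List (𝓜.Model n)) (e : Example (Fin n))
    (b : Bool) : ℕ :=
  E.countP fun M => decide (𝓜.classify M e = some b)

/-- Majority vote: `b` if at least `⌊|E| / 2⌋ + 1` members of the ensemble `E` classify `e` as `b`.
If neither class reaches this majority (a tie), the outcome is `tie`, where `tie = none` means that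
`e` is left unclassified. -/
def ModelType.majority (𝓜 : ModelType) (tie : Option Bool) {n : ℕ} (E : List (𝓜.Model n))
    (e : Example (Fin n)) : Option Bool :=
  if E.length / 2 + 1 ≤ 𝓜.votes E e true then some true
  else if E.length / 2 + 1 ≤ 𝓜.votes E e false then some false
  else tie

/-- Ensembles of at most `s` models of type `𝓜`, with a fixed convention for ties. The members are
listed, and several of them may be copies of the same model. -/
def ModelType.ensembles (𝓜 : ModelType) (s : ℕ) (tie : Option Bool) : ModelType where
  Model n := {E : List (𝓜.Model n) // E.length ≤ s}
  encode E := encodeList 𝓜.encode E.val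
  classify E e := 𝓜.majority tie E.val e
  termSize E := (E.val.map 𝓜.termSize).foldr max 0

/-! ## Local contrastive explanations -/

/-- `A` is a local contrastive explanation for `e` with respect to the classification `M`: some
example that differs from `e` only on features in `A` gets the other class. -/
def IsContrastiveExplanation {F : Type} (M : Example F → Option Bool) (e : Example F)
    (A : Finset F) : Prop :=
  ∃ e' : Example F, (∀ f, f ∉ A → e' f = e f) ∧ ∃ b : Bool, M e = some b ∧ M e' = some (!b)

/-- An instance of the cardinality-minimal local contrastive explanation problem: a model, an
example over its features, and a bound on the size of the explanation. -/
structure LCXpInstance (𝓜 : ModelType) where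
  numFeatures : ℕ
  model : 𝓜.Model numFeatures
  ex : Example (Fin numFeatures)
  bound : ℕ

/-- The model, the example as the list of all pairs (feature, value), and the bound. -/
def LCXpInstance.encode {𝓜 : ModelType} (x : LCXpInstance 𝓜) : Data :=
  Data.pair (𝓜.encode x.model)
    (Data.pair (encodeTerm (List.ofFn fun i : Fin x.numFeatures => (i, x.ex i)))
      (encodeNat x.bound))

/-- The problem: is there a local contrastive explanation of size at most the given bound?
The parameter is the sum of the size of a largest term and of the bound on the size of the
explanation. -/
def lCXpCard (𝓜 : ModelType) : ParamProblem where
  Instance := LCXpInstance 𝓜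
  encode := LCXpInstance.encode
  param x := 𝓜.termSize x.model + x.bound
  Yes x := ∃ A : Finset (Fin x.numFeatures), A.card ≤ x.bound ∧
    IsContrastiveExplanation (𝓜.classify x.model) x.ex A

/-! A decision set with default class `b` is the decision list that gives `1 - b` to each of its
terms and ends with the empty term and `b`. So it suffices to treat at most `s` decision lists under
a vote, a single model being an ensemble of one.

Guess, in each list, the first rule that applies. For constant `s` there are only polynomially many
guesses. A guess fixes all classes, hence the outcome of the vote, and an example realizes it iff it
satisfies a CNF: a unit clause for each literal of a chosen term, and the negation of each earlier
term. Clauses have at most `w = max(term_size, 1)` literals. The question becomes whether some guess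
with the opposite outcome has a CNF with a solution at Hamming distance at most `k` from the given
example. Bounded search decides this: a violated clause contains a literal that the solution
satisfies, so branching over its literals has a branch that gets one step closer. Depth `k` and
branching at most `w` keep the search tree within a function of the parameter times a polynomial
(`len_foldl_expand_le`). Correctness is `exists_outcome_iff` for guesses, `exists_mem_foldl_expand`
and `differs_of_mem_foldl_expand` for the search, and `flipsFrom_iff` for both together.

Running times come from closure properties of `PolyTime`. There `len` is only required to dominate
the size of the encoding, so an instance may be given a length padded by a function of its
parameter. The algorithm is polynomial in the padded length, and `isFPT_of_decisionLists` turns this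
into an FPT bound. -/

/-! ## Encoded types -/

/-- A type whose elements are written as data, with a length that is at least about the size of
the encoding. -/
class Encoded (α : Type) where
  enc : α → Data
  len : α → ℕ
  size_add_two_le : ∀ a, (enc a).size + 2 ≤ len a

open Encoded

/-- Lets powers of the length absorb constants and sums. -/
theorem two_le_len {α : Type} [Encoded α] (a : α) : 2 ≤ len a :=
  (Nat.le_add_left 2 _).trans (size_add_two_le a)

instance : Encoded Unit where
  enc _ := BinaryTree.nil
  len _ := 2
  size_add_two_le _ := le_refl _

instance : Encoded Bool where
  enc := encodeBool
  len b := (encodeBool b).size + 2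
  size_add_two_le _ := le_refl _

instance {α β : Type} [Encoded α] [Encoded β] : Encoded (α × β) where
  enc p := Data.pair (enc p.1) (enc p.2)
  len p := len p.1 + len p.2
  size_add_two_le p := by
    have h1 := size_add_two_le p.1
    have h2 := size_add_two_le p.2
    simp only [Data.size, BinaryTree.numNodes] at *
    omega

/-- The length of a list: two more than the total length of its elements. -/
def listLen {α : Type} [Encoded α] (l : List α) : ℕ := (l.map len).sum + 2

instance {α : Type} [Encoded α] : Encoded (List α) where
  enc := encodeList enc
  len := listLen
  size_add_two_le l := by
    induction l with
    | nil => simp [encodeList, listLen]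
    | cons a l ih =>
      have h := size_add_two_le a
      simp only [Data.size, encodeList, listLen, BinaryTree.numNodes, List.map_cons,
        List.sum_cons] at *
      omega

instance : Encoded ℕ where
  enc := encodeNat
  len n := len n.bits
  size_add_two_le n := size_add_two_le n.bits

section Len

variable {α β : Type} [Encoded α] [Encoded β]

@[simp] theorem enc_prod (a : α) (b : β) : enc (a, b) = Data.pair (enc a) (enc b) := rfl

@[simp] theorem len_prod (a : α) (b : β) : len (a, b) = len a + len b := rfl

@[simp] theorem enc_list_nil : enc ([] : List α) = BinaryTree.nil := rfl

@[simp] theorem enc_list_cons (a : α) (l : List α) :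
    enc (a :: l) = Data.pair (enc a) (enc l) := rfl

@[simp] theorem len_list_nil : len ([] : List α) = 2 := rfl

theorem len_list (l : List α) : len l = (l.map len).sum + 2 := rfl

@[simp] theorem len_list_cons (a : α) (l : List α) : len (a :: l) = len a + len l := by
  simp only [len_list, List.map_cons, List.sum_cons, add_assoc]

theorem len_append (l m : List α) : len (l ++ m) + 2 = len l + len m := by
  simp only [len_list, List.map_append, List.sum_append]
  omega

theorem len_append_le (l m : List α) : len (l ++ m) ≤ len l + len m :=
  (Nat.le_add_right _ 2).trans (len_append l m).le

theorem length_le_len (l : List α) : l.length ≤ len l := by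
  induction l with
  | nil => simp
  | cons a l ih =>
    have := two_le_len a
    simp only [List.length_cons, len_list_cons]
    omega

theorem len_le_of_mem {a : α} {l : List α} (h : a ∈ l) : len a ≤ len l := by
  rw [len_list]
  exact (List.le_sum_of_mem (List.mem_map_of_mem h)).trans (Nat.le_add_right _ _)

theorem len_le_of_sublist {l m : List α} (h : l.Sublist m) : len l ≤ len m := by
  induction h with
  | slnil => exact le_refl _
  | cons a _ ih => simp only [len_list_cons]; omega
  | cons_cons a _ ih => simp only [len_list_cons]; omega

theorem len_reverse (l : List α) : len l.reverse = len l := by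
  simp only [len_list, List.map_reverse, List.sum_reverse]

theorem len_list_le {l : List α} {B : ℕ} (h : ∀ a ∈ l, len a ≤ B) : len l ≤ l.length * B + 2 := by
  rw [len_list]
  have := List.sum_le_card_nsmul (l.map len) B (by simpa using h)
  simpa using this

theorem len_bool_le (b : Bool) : len b ≤ 3 := by
  cases b <;> simp [len, encodeBool]

end Len

/-! ## Polynomial bounds -/

/-- A function is bounded by a power of the length of its argument. -/
def PolyBdd {α : Type} [Encoded α] (g : α → ℕ) : Prop := ∃ c : ℕ, ∀ a, g a ≤ len a ^ c

namespace PolyBdd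

variable {α β : Type} [Encoded α] [Encoded β]

theorem mono {g h : α → ℕ} (hh : PolyBdd h) (hgh : ∀ a, g a ≤ h a) : PolyBdd g :=
  let ⟨c, hc⟩ := hh
  ⟨c, fun a => (hgh a).trans (hc a)⟩

theorem len_self : PolyBdd (len : α → ℕ) := ⟨1, fun _ => (pow_one _).ge⟩

theorem const (n : ℕ) : PolyBdd fun _ : α => n :=
  ⟨n, fun a => n.lt_two_pow_self.le.trans (Nat.pow_le_pow_left (two_le_len a) n)⟩

theorem mul {g h : α → ℕ} (hg : PolyBdd g) (hh : PolyBdd h) : PolyBdd fun a => g a * h a :=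
  let ⟨c, hc⟩ := hg
  let ⟨d, hd⟩ := hh
  ⟨c + d, fun a => (Nat.mul_le_mul (hc a) (hd a)).trans (pow_add _ _ _).ge⟩

theorem add {g h : α → ℕ} (hg : PolyBdd g) (hh : PolyBdd h) : PolyBdd fun a => g a + h a := by
  obtain ⟨c, hc⟩ := hg
  obtain ⟨d, hd⟩ := hh
  refine ⟨c + d + 1, fun a => ?_⟩
  have h2 := two_le_len a
  have h1 : len a ^ c ≤ len a ^ (c + d) := Nat.pow_le_pow_right (by omega) (by omega)
  have h3 : len a ^ d ≤ len a ^ (c + d) := Nat.pow_le_pow_right (by omega) (by omega)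
  calc g a + h a ≤ len a ^ (c + d) + len a ^ (c + d) :=
        add_le_add ((hc a).trans h1) ((hd a).trans h3)
    _ = len a ^ (c + d) * 2 := by ring
    _ ≤ len a ^ (c + d + 1) := by rw [pow_succ]; exact Nat.mul_le_mul_left _ h2

theorem comp {g : β → ℕ} (hg : PolyBdd g) {f : α → β} (hf : PolyBdd fun a => len (f a)) :
    PolyBdd fun a => g (f a) := by
  obtain ⟨c, hc⟩ := hg
  obtain ⟨d, hd⟩ := hf
  refine ⟨d * c, fun a => (hc _).trans ?_⟩
  rw [pow_mul]
  exact Nat.pow_le_pow_left (hd a) c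

/-- A polynomially bounded function is uniformly bounded on arguments of polynomial length. -/
theorem bound_of_len_le {g : β → ℕ} (hg : PolyBdd g) {h : α → ℕ} (hh : PolyBdd h) :
    ∃ k : α → ℕ, PolyBdd k ∧ ∀ a b, len b ≤ h a → g b ≤ k a := by
  obtain ⟨c, hc⟩ := hg
  obtain ⟨d, hd⟩ := hh
  refine ⟨fun a => len a ^ (d * c), ⟨d * c, fun _ => le_refl _⟩, fun a b hb => (hc b).trans ?_⟩
  simp only [pow_mul]
  exact Nat.pow_le_pow_left (hb.trans (hd a)) c

end PolyBdd

/-! ## Functions computed in polynomial time -/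

/-- A function on encoded types that some program computes in polynomial time, with values of
polynomial length. -/
def PolyTime {α β : Type} [Encoded α] [Encoded β] (f : α → β) : Prop :=
  ∃ (p : Prog) (T : α → ℕ), PolyBdd T ∧ (PolyBdd fun a => len (f a)) ∧
    ∀ a, ∃ t ≤ T a, p.Runs (enc a) (enc (f a)) t

theorem Prog.exists_const (d : Data) : ∃ (p : Prog) (t : ℕ), ∀ x, p.Runs x d t := by
  induction d with
  | nil => exact ⟨.nil, 1, fun x => .nil x⟩
  | node _ a b iha ihb =>
    obtain ⟨p, s, hp⟩ := iha
    obtain ⟨q, t, hq⟩ := ihb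
    exact ⟨.pair p q, s + t + 1, fun x => .pair (hp x) (hq x)⟩

/-- The loop keeps the remaining list, the fixed argument and the accumulator as its state. One
round costs the step of the fold plus 22 for rearranging the state. The bound `M` is only demanded
at accumulators that actually occur. -/
theorem Prog.exists_foldl_loop {α β γ : Type} [Encoded α] [Encoded β] [Encoded γ]
    {S : α × β × γ → γ} {q : Prog} {T : α × β × γ → ℕ}
    (hq : ∀ x, ∃ t ≤ T x, q.Runs (enc x) (enc (S x)) t) :
    ∃ p : Prog, ∀ (a : α) (M : ℕ) (l : List β) (c : γ),
      (∀ l₁ b l₂, l = l₁ ++ b :: l₂ → T (a, b, l₁.foldl (fun c b => S (a, b, c)) c) ≤ M) →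
      ∃ t ≤ l.length * (M + 22) + 2,
        p.Runs (enc (l, a, c)) (enc (([] : List β), a, l.foldl (fun c b => S (a, b, c)) c)) t := by
  refine ⟨.loop .hd (.pair (.comp .tl .hd) (.pair (.comp .hd .tl)
    (.comp q (.pair (.comp .hd .tl) (.pair (.comp .hd .hd) (.comp .tl .tl)))))), ?_⟩
  intro a M l
  induction l with
  | nil =>
    intro c _
    exact ⟨2, by omega, Prog.Runs.loop_stop (.hd _ _)⟩
  | cons b l ih =>
    intro c hM
    obtain ⟨s, hs, hqs⟩ := hq (a, b, c)
    obtain ⟨t, ht, hrun⟩ := ih (S (a, b, c)) fun l₁ b' l₂ h =>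
      hM (b :: l₁) b' l₂ (by rw [h]; rfl)
    have h0 : T (a, b, c) ≤ M := hM [] b l rfl
    refine ⟨_, ?_, .loop_step (.hd _ _) (by simp)
      (.pair (.comp (.hd _ _) (.tl _ _)) (.pair (.comp (.tl _ _) (.hd _ _)) (.comp
        (.pair (.comp (.tl _ _) (.hd _ _)) (.pair (.comp (.hd _ _) (.hd _ _))
          (.comp (.tl _ _) (.tl _ _)))) hqs))) hrun⟩
    simp only [List.length_cons, add_mul]
    omega

namespace PolyTime

section Basic

variable {α β γ δ : Type} [Encoded α] [Encoded β] [Encoded γ] [Encoded δ]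

theorem len_le {f : α → β} (hf : PolyTime f) : PolyBdd fun a => len (f a) :=
  let ⟨_, _, _, h, _⟩ := hf
  h

/-- The identity program computes any change of view that leaves the encoding unchanged. -/
theorem of_enc_eq {f : α → β} (h : ∀ a, enc (f a) = enc a) (hl : PolyBdd fun a => len (f a)) :
    PolyTime f :=
  ⟨.id, fun _ => 1, .const 1, hl, fun a => ⟨1, le_refl _, by rw [h]; exact .id _⟩⟩

protected theorem id : PolyTime fun a : α => a := of_enc_eq (fun _ => rfl) .len_self

theorem const (b : β) : PolyTime fun _ : α => b :=
  let ⟨p, t, hp⟩ := Prog.exists_const (enc b)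
  ⟨p, fun _ => t, .const t, .const _, fun _ => ⟨t, le_refl _, hp _⟩⟩

theorem comp {g : β → γ} {f : α → β} (hg : PolyTime g) (hf : PolyTime f) :
    PolyTime fun a => g (f a) := by
  obtain ⟨p, T, hT, hl, hp⟩ := hf
  obtain ⟨q, U, hU, hm, hq⟩ := hg
  refine ⟨.comp q p, fun a => T a + U (f a) + 1, (hT.add (hU.comp hl)).add (.const 1),
    hm.comp hl, fun a => ?_⟩
  obtain ⟨s, hs, hps⟩ := hp a
  obtain ⟨t, ht, hqt⟩ := hq (f a)
  exact ⟨s + t + 1, by beta_reduce; omega, .comp hps hqt⟩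

theorem pair {f : α → β} {g : α → γ} (hf : PolyTime f) (hg : PolyTime g) :
    PolyTime fun a => (f a, g a) := by
  obtain ⟨p, T, hT, hl, hp⟩ := hf
  obtain ⟨q, U, hU, hm, hq⟩ := hg
  refine ⟨.pair p q, fun a => T a + U a + 1, (hT.add hU).add (.const 1), hl.add hm, fun a => ?_⟩
  obtain ⟨s, hs, hps⟩ := hp a
  obtain ⟨t, ht, hqt⟩ := hq a
  exact ⟨s + t + 1, by beta_reduce; omega, .pair hps hqt⟩

theorem fst : PolyTime fun p : α × β => p.1 :=
  ⟨.hd, fun _ => 1, .const 1, PolyBdd.len_self.mono fun _ => Nat.le_add_right _ _,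
    fun _ => ⟨1, le_refl _, .hd _ _⟩⟩

theorem snd : PolyTime fun p : α × β => p.2 :=
  ⟨.tl, fun _ => 1, .const 1, PolyBdd.len_self.mono fun _ => Nat.le_add_left _ _,
    fun _ => ⟨1, le_refl _, .tl _ _⟩⟩

theorem fst' {f : α → β × γ} (hf : PolyTime f) : PolyTime fun a => (f a).1 := fst.comp hf

theorem snd' {f : α → β × γ} (hf : PolyTime f) : PolyTime fun a => (f a).2 := snd.comp hf

theorem ite {b : α → Bool} {f g : α → β} (hb : PolyTime b) (hf : PolyTime f) (hg : PolyTime g) :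
    PolyTime fun a => if b a = true then f a else g a := by
  obtain ⟨r, V, hV, -, hr⟩ := hb
  obtain ⟨p, T, hT, hl, hp⟩ := hf
  obtain ⟨q, U, hU, hm, hq⟩ := hg
  refine ⟨.cond r p q, fun a => V a + (T a + U a) + 1, (hV.add (hT.add hU)).add (.const 1),
    (hl.add hm).mono fun a => ?_, fun a => ?_⟩
  · beta_reduce; split <;> omega
  · obtain ⟨i, hi, hri⟩ := hr a
    obtain ⟨s, hs, hps⟩ := hp a
    obtain ⟨t, ht, hqt⟩ := hq a
    cases hba : b a with
    | true =>
      rw [hba] at hri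
      exact ⟨i + s + 1, by beta_reduce; omega,
        .cond_true hri (by simp [enc, encodeBool]) (by simpa [hba] using hps)⟩
    | false =>
      rw [hba] at hri
      exact ⟨i + t + 1, by beta_reduce; omega, .cond_false hri (by simpa [hba] using hqt)⟩

theorem listCases {l : α → List β} {f : α → γ} {g : α × β × List β → γ} (hl : PolyTime l)
    (hf : PolyTime f) (hg : PolyTime g) :
    PolyTime fun a => match l a with
      | [] => f a
      | b :: m => g (a, b, m) := by
  obtain ⟨r, V, hV, hk, hr⟩ := hl
  obtain ⟨p, T, hT, hl, hp⟩ := hf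
  obtain ⟨q, U, hU, hm, hq⟩ := hg
  obtain ⟨K, hK, hUK⟩ := hU.bound_of_len_le (PolyBdd.len_self.add hk)
  obtain ⟨K', hK', hmK⟩ := hm.bound_of_len_le (PolyBdd.len_self.add hk)
  refine ⟨
      -- An encoded list is `nil` iff it is empty and is otherwise the pair of head and tail, so it
      -- serves both as the test and as the data for `q`.
      .cond r (.comp q (.pair .id r)) p, fun a => 2 * V a + (T a + K a) + 5,
    ((((PolyBdd.const 2).mul hV).add (hT.add hK))).add (.const 5),
    (hl.add hK').mono fun a => ?_, fun a => ?_⟩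
  · have hlen := hmK a
    beta_reduce
    cases hla : l a with
    | nil => exact Nat.le_add_right _ _
    | cons b m =>
      have := hlen (a, b, m) (by rw [hla]; exact le_refl _)
      simp only
      omega
  · obtain ⟨i, hi, hri⟩ := hr a
    beta_reduce
    cases hla : l a with
    | nil =>
      obtain ⟨s, hs, hps⟩ := hp a
      rw [hla] at hri
      exact ⟨i + s + 1, by omega, .cond_false hri hps⟩
    | cons b m =>
      obtain ⟨t, ht, hqt⟩ := hq (a, b, m)
      have := hUK a (a, b, m) (by rw [hla]; exact le_refl _)
      rw [hla] at hri
      exact ⟨i + (1 + i + 1 + t + 1) + 1, by omega,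
        .cond_true hri (by simp) (.comp (.pair (.id _) hri) hqt)⟩

/-- Iterating a polynomial-time step may produce exponentially long values, so a polynomial bound on
every intermediate accumulator has to be supplied. -/
theorem foldl {l : α → List β} {c : α → γ} {S : α × β × γ → γ} (hl : PolyTime l) (hc : PolyTime c)
    (hS : PolyTime S) {B : α → ℕ} (hB : PolyBdd B)
    (hlen : ∀ a m, m <+: l a → len (m.foldl (fun x b => S (a, b, x)) (c a)) ≤ B a) :
    PolyTime fun a => (l a).foldl (fun x b => S (a, b, x)) (c a) := by
  obtain ⟨q, U, hU, -, hq⟩ := hS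
  obtain ⟨r, hr⟩ := Prog.exists_foldl_loop hq
  obtain ⟨p, T, hT, hlp, hp⟩ := hl.pair ((PolyTime.id).pair hc)
  obtain ⟨K, hK, hUK⟩ := hU.bound_of_len_le ((PolyBdd.len_self.add hl.len_le).add hB)
  refine ⟨.comp (.comp .tl .tl) (.comp r p),
    fun a => T a + (len (l a) * (K a + 22) + 2) + 6,
    (hT.add ((hl.len_le.mul (hK.add (.const 22))).add (.const 2))).add (.const 6),
    hB.mono fun a => hlen a _ List.prefix_rfl, fun a => ?_⟩
  obtain ⟨s, hs, hps⟩ := hp a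
  obtain ⟨t, ht, hrt⟩ := hr a (K a) (l a) (c a) (by
    intro l₁ b l₂ h
    apply hUK
    have h1 := hlen a l₁ (by rw [h]; exact List.prefix_append _ _)
    have h2 : len b ≤ len (l a) := len_le_of_mem (by rw [h]; simp)
    simp only [len_prod]
    omega)
  refine ⟨s + t + 1 + 3 + 1, ?_, .comp (.comp hps hrt) (.comp (.tl _ _) (.tl _ _))⟩
  have := Nat.mul_le_mul_right (K a + 22) (length_le_len (l a))
  beta_reduce
  omega

end Basic

end PolyTime

/-! ### Polynomial-time operations on lists and Booleans -/

namespace PolyTime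

section Lists

variable {α β γ δ : Type} [Encoded α] [Encoded β] [Encoded γ] [Encoded δ]

theorem of_eq {f g : α → β} (hf : PolyTime f) (h : ∀ a, f a = g a) : PolyTime g :=
  funext h ▸ hf

theorem comp₂ {f : α × β → γ} (hf : PolyTime f) {g : δ → α} {h : δ → β} (hg : PolyTime g)
    (hh : PolyTime h) : PolyTime fun a => f (g a, h a) :=
  hf.comp (hg.pair hh)

theorem cons {f : α → β} {g : α → List β} (hf : PolyTime f) (hg : PolyTime g) :
    PolyTime fun a => f a :: g a :=
  (of_enc_eq (f := fun p : β × List β => p.1 :: p.2) (fun _ => rfl)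
    (PolyBdd.len_self.mono fun p => (len_list_cons p.1 p.2).le)).comp₂ hf hg

theorem reverse {l : α → List β} (hl : PolyTime l) : PolyTime fun a => (l a).reverse := by
  have hrev : ∀ m : List β, m.foldl (fun x b => b :: x) [] = m.reverse := fun m => by simp
  have h := foldl (c := fun _ => []) (S := fun p : α × β × List β => p.2.1 :: p.2.2) hl (const _)
    (cons snd.fst' snd.snd') hl.len_le (fun a m hm => by
      simp only [hrev, len_reverse]
      exact len_le_of_sublist hm.sublist)
  simpa only [hrev] using h

theorem foldr {l : α → List β} {c : α → γ} {f : α → β → γ → γ} (hl : PolyTime l)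
    (hc : PolyTime c) (hf : PolyTime fun p : α × β × γ => f p.1 p.2.1 p.2.2) {B : α → ℕ}
    (hB : PolyBdd B) (hlen : ∀ a m, m <:+ l a → len (m.foldr (f a) (c a)) ≤ B a) :
    PolyTime fun a => (l a).foldr (f a) (c a) := by
  have h := foldl hl.reverse hc hf hB fun a m hm => by
    have := hlen a m.reverse (by rw [← List.reverse_prefix, List.reverse_reverse]; exact hm)
    rwa [List.foldr_reverse] at this
  simpa only [List.foldl_reverse] using h

theorem append {f g : α → List β} (hf : PolyTime f) (hg : PolyTime g) :
    PolyTime fun a => f a ++ g a := by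
  have h := foldr (f := fun _ b x => b :: x) hf hg (cons snd.fst' snd.snd')
    (hf.len_le.add hg.len_le) fun a m hm => by
      rw [List.foldr_cons_eq_append, List.map_id']
      exact (len_append_le _ _).trans (Nat.add_le_add_right (len_le_of_sublist hm.sublist) _)
  exact h.of_eq fun a => by rw [List.foldr_cons_eq_append, List.map_id']

theorem len_flatten_le (l : List (List β)) : len l.flatten ≤ len l := by
  induction l with
  | nil => exact le_refl _
  | cons a l ih =>
    have := len_append_le a l.flatten
    simp only [List.flatten_cons, len_list_cons]
    omega

theorem flatten {l : α → List (List β)} (hl : PolyTime l) : PolyTime fun a => (l a).flatten := by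
  have hfl : ∀ m : List (List β), m.foldr (fun b x => b ++ x) [] = m.flatten := fun m => by
    induction m with
    | nil => rfl
    | cons b m ih => rw [List.foldr_cons, ih, List.flatten_cons]
  have h := foldr (c := fun _ => []) (f := fun _ b x => b ++ x) hl (const _)
    (append snd.fst' snd.snd') hl.len_le fun _ m hm => by
      rw [hfl]
      exact (len_flatten_le m).trans (len_le_of_sublist hm.sublist)
  simpa only [hfl] using h

theorem map {l : α → List β} {f : α → β → γ} (hl : PolyTime l)
    (hf : PolyTime fun p : α × β => f p.1 p.2) : PolyTime fun a => (l a).map (f a) := by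
  obtain ⟨K, hK, hfK⟩ := hf.len_le.bound_of_len_le (PolyBdd.len_self.add hl.len_le)
  have h := foldr (c := fun _ => []) (f := fun a b x => f a b :: x) hl (const _)
    (cons (hf.comp₂ fst snd.fst') snd.snd')
    ((hl.len_le.mul hK).add (.const 2)) fun a m hm => by
      rw [List.foldr_cons_eq_append, List.append_nil]
      refine (len_list_le (B := K a) fun c hc => ?_).trans (Nat.add_le_add_right
        (Nat.mul_le_mul_right _ ?_) _)
      · obtain ⟨b, hb, rfl⟩ := List.mem_map.1 hc
        exact hfK a (a, b) (Nat.add_le_add_left (len_le_of_mem (hm.mem hb)) _)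
      · rw [List.length_map]
        exact hm.length_le.trans (length_le_len _)
  simpa only [List.foldr_cons_eq_append, List.append_nil] using h

theorem flatMap {l : α → List β} {f : α → β → List γ} (hl : PolyTime l)
    (hf : PolyTime fun p : α × β => f p.1 p.2) : PolyTime fun a => (l a).flatMap (f a) := by
  simpa only [List.flatMap_def] using (map hl hf).flatten

theorem not {f : α → Bool} (hf : PolyTime f) : PolyTime fun a => !f a :=
  (ite hf (const false) (const true)).of_eq fun a => by cases f a <;> rfl

theorem and {f g : α → Bool} (hf : PolyTime f) (hg : PolyTime g) : PolyTime fun a => f a && g a :=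
  (ite hf hg (const false)).of_eq fun a => by cases f a <;> rfl

theorem or {f g : α → Bool} (hf : PolyTime f) (hg : PolyTime g) : PolyTime fun a => f a || g a :=
  (ite hf (const true) hg).of_eq fun a => by cases f a <;> rfl

theorem beq {f g : α → Bool} (hf : PolyTime f) (hg : PolyTime g) :
    PolyTime fun a => f a == g a :=
  (ite hf hg hg.not).of_eq fun a => by cases f a <;> cases g a <;> rfl

theorem foldrBool {l : α → List β} {c : α → Bool} {f : α → β → Bool → Bool} (hl : PolyTime l)
    (hc : PolyTime c) (hf : PolyTime fun p : α × β × Bool => f p.1 p.2.1 p.2.2) :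
    PolyTime fun a => (l a).foldr (f a) (c a) :=
  foldr hl hc hf (.const 3) fun _ _ _ => len_bool_le _

theorem any {l : α → List β} {f : α → β → Bool} (hl : PolyTime l)
    (hf : PolyTime fun p : α × β => f p.1 p.2) : PolyTime fun a => (l a).any (f a) :=
  (foldrBool (f := fun a b x => f a b || x) hl (const false)
    (or (hf.comp₂ fst snd.fst') snd.snd')).of_eq fun a => by
    induction l a with
    | nil => rfl
    | cons b m ih => simp only [List.foldr_cons, List.any_cons, ih]

theorem all {l : α → List β} {f : α → β → Bool} (hl : PolyTime l)
    (hf : PolyTime fun p : α × β => f p.1 p.2) : PolyTime fun a => (l a).all (f a) :=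
  (any (f := fun a b => !f a b) hl hf.not).not.of_eq fun a => by
    rw [← List.not_all_eq_any_not, Bool.not_not]

theorem filter {l : α → List β} {f : α → β → Bool} (hl : PolyTime l)
    (hf : PolyTime fun p : α × β => f p.1 p.2) : PolyTime fun a => (l a).filter (f a) :=
  (flatMap (f := fun a b => if f a b = true then [b] else []) hl
    (ite hf (cons snd (const [])) (const []))).of_eq fun a => by
    induction l a with
    | nil => rfl
    | cons b m ih =>
      rw [List.flatMap_cons, ih, List.filter_cons]
      split <;> rfl

theorem tail {l : α → List β} (hl : PolyTime l) : PolyTime fun a => (l a).tail :=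
  (listCases hl (const []) snd.snd').of_eq fun a => by cases l a <;> rfl

theorem isEmpty {l : α → List β} (hl : PolyTime l) : PolyTime fun a => (l a).isEmpty :=
  (listCases hl (const true) (const false)).of_eq fun a => by cases l a <;> rfl

/-- Serves to compare lengths without arithmetic: the result is empty iff `m a` is at most as long
as `l a`. -/
theorem drop_length {l : α → List β} {m : α → List γ} (hl : PolyTime l) (hm : PolyTime m) :
    PolyTime fun a => (m a).drop (l a).length := by
  have hdrop : ∀ (k : List β) (n : List γ), k.foldl (fun x _ => x.tail) n = n.drop k.length := by
    intro k
    induction k with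
    | nil => intro n; rfl
    | cons b k ih => intro n; simp [ih]
  have h := foldl (S := fun p : α × β × List γ => p.2.2.tail) hl hm snd.snd'.tail hm.len_le
    fun a k _ => by
      simp only [hdrop]
      exact len_le_of_sublist (List.drop_sublist _ _)
  simpa only [hdrop] using h

theorem len_tails_le (l : List β) : len l.tails ≤ (len l + 1) * len l + 2 := by
  refine (len_list_le fun m hm => len_le_of_sublist ((List.mem_tails _ _).1 hm).sublist).trans ?_
  rw [List.length_tails]
  exact Nat.add_le_add_right (Nat.mul_le_mul_right _ (Nat.succ_le_succ (length_le_len l))) _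

theorem tails {l : α → List β} (hl : PolyTime l) : PolyTime fun a => (l a).tails := by
  let f : β → List (List β) → List (List β) := fun b x =>
    match x with
    | [] => []
    | m :: k => (b :: m) :: m :: k
  have htails : ∀ k : List β, k.foldr f [[]] = k.tails := by
    intro k
    induction k with
    | nil => rfl
    | cons b k ih =>
      rw [List.foldr_cons, ih]
      cases k <;> rfl
  have hf : PolyTime fun p : α × β × List (List β) => f p.2.1 p.2.2 :=
    (listCases (g := fun q : (α × β × List (List β)) × List β × List (List β) =>
        (q.1.2.1 :: q.2.1) :: q.2.1 :: q.2.2) snd.snd' (const [])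
      (cons (cons fst.snd'.fst' snd.fst') (cons snd.fst' snd.snd'))).of_eq
      fun p => by rcases p with ⟨_, _, _ | _⟩ <;> rfl
  have h := foldr (c := fun _ => [[]]) (f := fun _ => f) hl (const _) hf
    (((hl.len_le.add (.const 1)).mul hl.len_le).add (.const 2)) fun a m hm => by
      rw [htails]
      refine (len_tails_le m).trans ?_
      have := len_le_of_sublist hm.sublist
      gcongr
  simpa only [htails] using h

/-- The number of iterations is fixed, not part of the input; this is where the ensemble size has to
be a constant. -/
theorem iterate {f : α → α} (hf : PolyTime f) (n : ℕ) : PolyTime f^[n] := by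
  induction n with
  | zero => exact PolyTime.id
  | succ n ih => exact ih.comp hf

/-- Comparing lists of bits while running through both. -/
theorem listBoolEq {f g : α → List Bool} (hf : PolyTime f) (hg : PolyTime g) :
    PolyTime fun a => decide (f a = g a) := by
  let S : Bool → Bool × List Bool → Bool × List Bool := fun b x =>
    match x.2 with
    | [] => (false, [])
    | c :: m => (x.1 && (b == c), m)
  have hS : PolyTime fun p : α × Bool × Bool × List Bool => S p.2.1 p.2.2 :=
    (listCases (g := fun q : (α × Bool × Bool × List Bool) × Bool × List Bool =>
        (q.1.2.2.1 && (q.1.2.1 == q.2.1), q.2.2)) snd.snd'.snd' (const (false, []))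
      (pair (and fst.snd'.snd'.fst' (beq fst.snd'.fst' snd.fst')) snd.snd')).of_eq
      fun p => by rcases p with ⟨_, _, _, _ | _⟩ <;> rfl
  have hlen : ∀ (k : List Bool) (x : Bool × List Bool),
      len (k.foldl (fun x b => S b x) x).2 ≤ len x.2 := by
    intro k
    induction k with
    | nil => intro x; exact le_refl _
    | cons b k ih =>
      rintro ⟨c, _ | ⟨d, m⟩⟩
      · exact ih _
      · exact (ih _).trans (by simp [S])
  -- Invariant of the simultaneous scan: the flag records agreement so far, and the lists are equal
  -- iff it survives and nothing of the second list is left.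
  have heq : ∀ (k : List Bool) (x : Bool × List Bool),
      ((k.foldl (fun x b => S b x) x).1 && (k.foldl (fun x b => S b x) x).2.isEmpty) =
        (x.1 && decide (k = x.2)) := by
    intro k
    induction k with
    | nil => rintro ⟨c, _ | ⟨d, m⟩⟩ <;> simp
    | cons b k ih =>
      rintro ⟨c, _ | ⟨d, m⟩⟩
      · rw [List.foldl_cons, ih]; simp [S]
      · rw [List.foldl_cons, ih]
        cases b <;> cases d <;> simp [S]
  have h := foldl (S := fun p : α × Bool × Bool × List Bool => S p.2.1 p.2.2) hf
    (pair (const true) hg) hS ((PolyBdd.const 3).add hg.len_le) fun a m _ =>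
      add_le_add (len_bool_le _) (hlen m _)
  exact (h.fst'.and h.snd'.isEmpty).of_eq fun a => by simp only [heq, Bool.true_and]

end Lists

/-! ### Numbers in binary and unary -/

section Nat

variable {α : Type} [Encoded α]

theorem nat_bits {f : α → ℕ} (hf : PolyTime f) : PolyTime fun a => (f a).bits :=
  (of_enc_eq (f := Nat.bits) (fun _ => rfl) .len_self).comp hf

/-- The unary notation of the number with the given bits. -/
def unaryOfBits (l : List Bool) : List Unit :=
  l.foldr (fun b x => (if b = true then [()] else []) ++ (x ++ x)) []

theorem length_unaryOfBits (n : ℕ) : (unaryOfBits n.bits).length = n := by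
  induction n using Nat.binaryRec' with
  | zero => simp [unaryOfBits]
  | bit b n h ih =>
    rw [Nat.bits_append_bit n b h]
    simp only [unaryOfBits, List.foldr_cons, List.length_append] at ih ⊢
    cases b <;> simp [Nat.bit, ih] <;> omega

theorem length_unaryOfBits_le {l m : List Bool} (h : l <:+ m) :
    (unaryOfBits l).length ≤ (unaryOfBits m).length := by
  obtain ⟨k, rfl⟩ := h
  induction k with
  | nil => exact le_refl _
  | cons b k ih =>
    refine ih.trans ?_
    simp only [unaryOfBits, List.cons_append, List.foldr_cons, List.length_append]
    omega

theorem bits_injective : Function.Injective Nat.bits := fun m n h => by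
  rw [← length_unaryOfBits m, h, length_unaryOfBits]

theorem natEq {f g : α → ℕ} (hf : PolyTime f) (hg : PolyTime g) :
    PolyTime fun a => decide (f a = g a) :=
  (listBoolEq hf.nat_bits hg.nat_bits).of_eq fun a => by simp only [bits_injective.eq_iff]

theorem len_list_unit (l : List Unit) : len l = l.length * 2 + 2 := by
  induction l with
  | nil => rfl
  | cons a l ih =>
    have : len a = 2 := rfl
    rw [len_list_cons, ih, this, List.length_cons]
    omega

/-- Unary notation can be exponentially longer than binary, hence the hypothesis that the value
itself is polynomially bounded. -/
theorem unary {f : α → ℕ} (hf : PolyTime f) (hb : PolyBdd f) :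
    PolyTime fun a => unaryOfBits (f a).bits :=
  foldr (f := fun _ b x => (if b = true then [()] else []) ++ (x ++ x)) hf.nat_bits (const [])
    (append (ite snd.fst' (const [()]) (const [])) (append snd.snd' snd.snd'))
    ((hb.mul (.const 2)).add (.const 2)) fun a m hm => by
      have := length_unaryOfBits_le hm
      rw [length_unaryOfBits] at this
      rw [len_list_unit]
      exact Nat.add_le_add_right (Nat.mul_le_mul_right _ this) _

end Nat

end PolyTime

/-! ## The algorithm -/

/-- The assignment given by a list of literals, the first of which prevails; other features are
`false`. -/
def value (A : List (Literal ℕ)) (f : ℕ) : Bool :=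
  A.foldr (fun l x => if decide (l.1 = f) = true then l.2 else x) false

/-- Whether an example satisfies a literal. -/
def holds (e : Example ℕ) (l : Literal ℕ) : Bool := e l.1 == l.2

/-- Whether an example satisfies every clause of a list, a clause being a disjunction of
literals. -/
def satisfies (e : Example ℕ) (C : List (List (Literal ℕ))) : Bool :=
  C.all fun c => c.any (holds e)

/-- The clauses saying that a rule applies but none of the rules in a list. -/
def ruleClauses (t : Term ℕ) (prev : List (Term ℕ × Bool)) : List (List (Literal ℕ)) :=
  (t.map fun l => [l]) ++ prev.map fun r => r.1.map fun l => (l.1, !l.2)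

/-- For each rule of a decision list, the clauses saying that it is the first rule that applies,
and its class. -/
def options (R : List (Term ℕ × Bool)) : List (List (List (Literal ℕ)) × Bool) :=
  R.reverse.tails.flatMap fun m =>
    match m with
    | [] => []
    | r :: prev => [(ruleClauses r.1 prev, r.2)]

/-- A choice of one option for each of several decision lists: all the clauses, and the resulting
classes. -/
abbrev Choice : Type := List (List (Literal ℕ)) × List Bool

/-- A state of the local search: a choice of options and an assignment. -/
abbrev SearchState : Type := Choice × List (Literal ℕ)

/-- Choices for several decision lists, extended by the options for one more decision list. -/
def extend (T : List Choice) (R : List (Term ℕ × Bool)) :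
    List Choice :=
  T.flatMap fun τ => (options R).map fun o => (o.1 ++ τ.1, o.2 :: τ.2)

/-- Moves the first of the remaining decision lists to the choices. -/
def extendStep
    (x : List (List (Term ℕ × Bool)) × List Choice) :
    List (List (Term ℕ × Bool)) × List Choice :=
  match x.1 with
  | [] => x
  | R :: E => (E, extend x.2 R)

/-- All choices of a first applicable rule in each of at most `s` decision lists. -/
def choices (s : ℕ) (E : List (List (Term ℕ × Bool))) :
    List Choice :=
  (extendStep^[s] (E, [([], [])])).2

/-- Whether `b` is the outcome of a majority vote with a convention for ties. -/
def isOutcome (tie : Option Bool) (b : Bool) (v : List Bool) : Bool :=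
  if decide (tie = some b) = true then
    ((v.filter fun c => c == !b).drop (v.filter fun c => c == b).length).isEmpty
  else
    !((v.filter fun c => c == b).drop (v.filter fun c => c == !b).length).isEmpty

/-- One round of local search: if a clause is violated, the ways to satisfy one of its
literals. -/
def expand (q : SearchState) :
    List SearchState :=
  match q.1.1.filter fun c => !c.any (holds (value q.2)) with
  | [] => [q]
  | c :: _ => c.map fun l => (q.1, l :: q.2)

/-- Local search from a given example, with one round for each element of the list `u`. -/
def localSearch (u : List Unit) (T : List Choice)
    (A : List (Literal ℕ)) : List SearchState :=
  u.foldl (fun L _ => L.flatMap expand) (T.map fun τ => (τ, A))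

/-- Whether an ensemble of at most `s` decision lists gives class `b` to the example `A`, and the
other class to some example that is found in `k` rounds of local search. -/
def flipsFrom (s : ℕ) (tie : Option Bool) (E : List (List (Term ℕ × Bool)))
    (A : List (Literal ℕ)) (k : ℕ) (b : Bool) : Bool :=
  ((choices s E).any fun τ => isOutcome tie b τ.2 && satisfies (value A) τ.1) &&
    (localSearch (PolyTime.unaryOfBits k.bits) (choices s E) A).any fun q =>
      isOutcome tie (!b) q.1.2 && satisfies (value q.2) q.1.1

/-! ## The running time -/

/-- All clauses of all choices have at most `w` literals. -/
def WidthLE (w : ℕ) (T : List Choice) : Prop :=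
  ∀ τ ∈ T, ∀ c ∈ τ.1, c.length ≤ w

/-- Negated earlier terms are as wide as the terms themselves; `1 ≤ w` accounts for the unit clauses
of the chosen term. -/
theorem length_le_of_mem_options {w : ℕ} {R : List (Term ℕ × Bool)}
    (hR : ∀ r ∈ R, r.1.length ≤ w) (hw : 1 ≤ w) {o} (ho : o ∈ options R) :
    ∀ c ∈ o.1, c.length ≤ w := by
  obtain ⟨m, hm, ho⟩ := List.mem_flatMap.1 ho
  have hm' := (List.mem_tails _ _).1 hm
  cases m with
  | nil => simp at ho
  | cons r prev =>
    rw [List.mem_singleton.1 ho]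
    intro c hc
    rcases List.mem_append.1 hc with hc | hc
    · obtain ⟨l, -, rfl⟩ := List.mem_map.1 hc
      exact hw
    · obtain ⟨r', hr', rfl⟩ := List.mem_map.1 hc
      rw [List.length_map]
      exact hR r' (List.mem_reverse.1 (hm'.mem (List.mem_cons_of_mem _ hr')))

theorem widthLE_extend {w : ℕ} {T} {R : List (Term ℕ × Bool)} (hT : WidthLE w T)
    (hR : ∀ r ∈ R, r.1.length ≤ w) (hw : 1 ≤ w) : WidthLE w (extend T R) := by
  intro τ hτ c hc
  obtain ⟨ρ, hρ, hτ⟩ := List.mem_flatMap.1 hτ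
  obtain ⟨o, ho, rfl⟩ := List.mem_map.1 hτ
  rcases List.mem_append.1 hc with hc | hc
  · exact length_le_of_mem_options hR hw ho c hc
  · exact hT ρ hρ c hc

theorem widthLE_choices {w : ℕ} (s : ℕ) {E : List (List (Term ℕ × Bool))}
    (hE : ∀ R ∈ E, ∀ r ∈ R, r.1.length ≤ w) (hw : 1 ≤ w) : WidthLE w (choices s E) := by
  have key : ∀ (s : ℕ) (x : List (List (Term ℕ × Bool)) × _),
      (∀ R ∈ x.1, ∀ r ∈ R, r.1.length ≤ w) → WidthLE w x.2 →
        WidthLE w (extendStep^[s] x).2 := by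
    intro s
    induction s with
    | zero => exact fun x _ h => h
    | succ s ih =>
      rintro ⟨_ | ⟨R, E⟩, T⟩ hE hT
      · exact ih _ hE hT
      · exact ih _ (fun R hR => hE R (List.mem_cons_of_mem _ hR))
          (widthLE_extend hT (hE R List.mem_cons_self) hw)
  exact key s _ hE (by simp [WidthLE])

/-! ### Growth of the local search -/

theorem fst_eq_of_mem_expand {q q' : SearchState} (h : q' ∈ expand q) : q'.1 = q.1 := by
  unfold expand at h
  split at h
  · rw [List.mem_singleton.1 h]
  · obtain ⟨l, -, rfl⟩ := List.mem_map.1 h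
    rfl

/-- There are at most `w` successors, or one if no clause is violated. The added literal already
occurs in a clause of the state, so a successor is at most twice as long. -/
theorem len_expand_le {w : ℕ} {q : SearchState} (hq : ∀ c ∈ q.1.1, c.length ≤ w) :
    len (expand q) ≤ (w + 1) * (2 * len q) + 2 := by
  unfold expand
  split
  · rw [len_list_cons, len_list_nil]
    nlinarith
  · rename_i c m hc
    have hc' : c ∈ q.1.1 := List.mem_of_mem_filter (hc ▸ List.mem_cons_self)
    refine (len_list_le (B := 2 * len q) fun q' hq' => ?_).trans ?_
    · obtain ⟨l, hl, rfl⟩ := List.mem_map.1 hq'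
      have h1 : len l ≤ len c := len_le_of_mem hl
      have h2 : len c ≤ len q.1.1 := len_le_of_mem hc'
      obtain ⟨⟨C, v⟩, A⟩ := q
      simp only [len_prod, len_list_cons] at h2 ⊢
      omega
    · rw [List.length_map]
      exact Nat.add_le_add_right (Nat.mul_le_mul_right _ ((hq c hc').trans (Nat.le_succ w))) _

/-- The constant 2 in `len_expand_le` is cancelled by the exact formula `len_append`, so a round
multiplies the length by a factor depending on `w` only. -/
theorem len_flatMap_expand_le {w : ℕ} {L : List SearchState}
    (hL : ∀ q ∈ L, ∀ c ∈ q.1.1, c.length ≤ w) :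
    len (L.flatMap expand) ≤ 2 * (w + 1) * len L := by
  induction L with
  | nil => simp only [List.flatMap_nil, len_list_nil]; nlinarith
  | cons q L ih =>
    have h1 := len_append (expand q) (L.flatMap expand)
    have h2 := len_expand_le (hL q List.mem_cons_self)
    have h3 := ih fun q' hq' => hL q' (List.mem_cons_of_mem _ hq')
    rw [List.flatMap_cons, len_list_cons]
    nlinarith

theorem len_foldl_expand_le {w : ℕ} (u : List Unit) {L : List SearchState}
    (hL : ∀ q ∈ L, ∀ c ∈ q.1.1, c.length ≤ w) :
    len (u.foldl (fun L _ => L.flatMap expand) L) ≤ (2 * (w + 1)) ^ u.length * len L := by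
  induction u generalizing L with
  | nil => simp
  | cons a u ih =>
    refine (ih (L := L.flatMap expand) fun q hq => ?_).trans ?_
    · obtain ⟨q', hq', hq⟩ := List.mem_flatMap.1 hq
      rw [fst_eq_of_mem_expand hq]
      exact hL q' hq'
    · rw [List.length_cons, pow_succ, mul_assoc]
      exact Nat.mul_le_mul_left _ (len_flatMap_expand_le hL)

/-! ### Polynomial time for the parts of the algorithm -/

section PolyTime

open PolyTime

variable {α : Type} [Encoded α]

theorem polyTime_holds {A : α → List (Literal ℕ)} {l : α → Literal ℕ} (hA : PolyTime A)
    (hl : PolyTime l) : PolyTime fun a => holds (value (A a)) (l a) :=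
  beq (foldrBool (f := fun a (l' : Literal ℕ) x =>
      if decide (l'.1 = (l a).1) = true then l'.2 else x) hA
    (const false) (ite (natEq snd.fst'.fst' (hl.comp fst).fst') snd.fst'.snd' snd.snd'))
    hl.snd'

theorem polyTime_anyHolds {A : α → List (Literal ℕ)} {c : α → List (Literal ℕ)} (hA : PolyTime A)
    (hc : PolyTime c) : PolyTime fun a => (c a).any (holds (value (A a))) :=
  any hc (polyTime_holds (hA.comp fst) snd)

theorem polyTime_satisfies {A : α → List (Literal ℕ)} {C : α → List (List (Literal ℕ))}
    (hA : PolyTime A) (hC : PolyTime C) : PolyTime fun a => satisfies (value (A a)) (C a) :=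
  all (f := fun a (c : List (Literal ℕ)) => c.any (holds (value (A a)))) hC
    (polyTime_anyHolds (hA.comp fst) snd)

theorem polyTime_ruleClauses {t : α → Term ℕ} {m : α → List (Term ℕ × Bool)}
    (ht : PolyTime t) (hm : PolyTime m) : PolyTime fun a => ruleClauses (t a) (m a) :=
  append (map (f := fun _ l => [l]) ht (cons snd (const [])))
    (map (f := fun _ r => r.1.map fun l => (l.1, !l.2)) hm
      (map (f := fun _ (l : Literal ℕ) => (l.1, !l.2)) snd.fst' (pair snd.fst' snd.snd'.not)))

theorem polyTime_options {R : α → List (Term ℕ × Bool)} (hR : PolyTime R) :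
    PolyTime fun a => options (R a) := by
  refine flatMap (f := fun _ m => match m with
    | [] => []
    | r :: prev => [(ruleClauses r.1 prev, r.2)]) hR.reverse.tails ?_
  exact (listCases (g := fun q : (α × List (Term ℕ × Bool)) × (Term ℕ × Bool) × _ =>
      [(ruleClauses q.2.1.1 q.2.2, q.2.1.2)]) snd (const [])
    (cons (pair (polyTime_ruleClauses snd.fst'.fst' snd.snd') snd.fst'.snd') (const []))).of_eq
      fun p => by rcases p with ⟨_, _ | _⟩ <;> rfl

theorem polyTime_extend {T : α → List Choice}
    {R : α → List (Term ℕ × Bool)} (hT : PolyTime T) (hR : PolyTime R) :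
    PolyTime fun a => extend (T a) (R a) :=
  flatMap (f := fun a τ => (options (R a)).map fun o => (o.1 ++ τ.1, o.2 :: τ.2)) hT
    (map (f := fun p : α × Choice =>
        fun o => (o.1 ++ p.2.1, o.2 :: p.2.2)) (polyTime_options (hR.comp fst))
      (pair (append snd.fst' fst.snd'.fst') (cons snd.snd' fst.snd'.snd')))

theorem polyTime_extendStep : PolyTime extendStep :=
  (listCases (l := fun x : List (List (Term ℕ × Bool)) × _ => x.1)
    (g := fun q => (q.2.2, extend q.1.2 q.2.1)) fst PolyTime.id
    (pair snd.snd' (polyTime_extend fst.snd' snd.fst'))).of_eq fun x => by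
      rcases x with ⟨_ | _, _⟩ <;> rfl

theorem polyTime_choices (s : ℕ) {E : α → List (List (Term ℕ × Bool))} (hE : PolyTime E) :
    PolyTime fun a => choices s (E a) :=
  ((iterate polyTime_extendStep s).comp (pair hE (const [([], [])]))).snd'

theorem polyTime_isOutcome (tie : Option Bool) (b : Bool) {v : α → List Bool} (hv : PolyTime v) :
    PolyTime fun a => isOutcome tie b (v a) := by
  have hf : ∀ c : Bool, PolyTime fun a => (v a).filter fun d => d == c := fun c =>
    filter (f := fun _ d => d == c) hv (beq snd (const c))
  exact ite (const _) (drop_length (hf b) (hf !b)).isEmpty (drop_length (hf !b) (hf b)).isEmpty.not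

theorem polyTime_expand : PolyTime expand := by
  refine (listCases
    (l := fun q : SearchState =>
      q.1.1.filter fun c => !c.any (holds (value q.2)))
    (g := fun r : SearchState × List (Literal ℕ) × _ => r.2.1.map fun l => (r.1.1, l :: r.1.2))
    (filter (f := fun (q : SearchState) (c : List (Literal ℕ)) => !c.any (holds (value q.2)))
      fst.fst' (polyTime_anyHolds fst.snd' snd).not)
    (cons PolyTime.id (const []))
    (map (f := fun (r : SearchState × List (Literal ℕ) × _) (l : Literal ℕ) =>
        (r.1.1, l :: r.1.2)) snd.fst'
      (pair fst.fst'.fst' (cons snd fst.fst'.snd')))).of_eq fun q => ?_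
  unfold expand
  cases q.1.1.filter fun c => !c.any (holds (value q.2)) <;> rfl

/-- The exponential growth of the search enters only through `hpow`, which padding the length of the
instances makes true. -/
theorem polyTime_localSearch {u : α → List Unit} {T : α → List Choice}
    {A : α → List (Literal ℕ)} (hu : PolyTime u) (hT : PolyTime T) (hA : PolyTime A)
    {w : α → ℕ} (hw : ∀ a, WidthLE (w a) (T a))
    (hpow : PolyBdd fun a => (2 * (w a + 1)) ^ (u a).length) :
    PolyTime fun a => localSearch (u a) (T a) (A a) := by
  have h0 : PolyTime fun a => (T a).map fun τ => (τ, A a) :=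
    map (f := fun a τ => (τ, A a)) hT (pair snd (hA.comp fst))
  refine foldl (S := fun p : α × Unit × List _ => p.2.2.flatMap expand) hu h0
    (flatMap (f := fun _ q => expand q) snd.snd' (polyTime_expand.comp snd))
    (hpow.mul h0.len_le) fun a m hm => ?_
  refine (len_foldl_expand_le m (w := w a) fun q hq => ?_).trans
    (Nat.mul_le_mul_right _ (Nat.pow_le_pow_right (by omega) hm.length_le))
  obtain ⟨τ, hτ, rfl⟩ := List.mem_map.1 hq
  exact hw a τ hτ

theorem polyTime_flipsFrom (s : ℕ) (tie : Option Bool) {E : α → List (List (Term ℕ × Bool))}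
    {A : α → List (Literal ℕ)} {k : α → ℕ} (hE : PolyTime E) (hA : PolyTime A) (hk : PolyTime k)
    {w : α → ℕ} (hw : ∀ a, ∀ R ∈ E a, ∀ r ∈ R, r.1.length ≤ w a) (hw1 : ∀ a, 1 ≤ w a)
    (hpow : PolyBdd fun a => (2 * (w a + 1)) ^ k a) (b : Bool) :
    PolyTime fun a => flipsFrom s tie (E a) (A a) (k a) b := by
  -- `k ≤ 2 ^ k ≤ (2 * (w + 1)) ^ k`, so the number of rounds can be written in unary.
  have hkb : PolyBdd k := hpow.mono fun a =>
    (Nat.lt_two_pow_self).le.trans (Nat.pow_le_pow_left (by omega) _)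
  have hT := polyTime_choices s hE
  have h1 : PolyTime fun a => (choices s (E a)).any fun τ =>
      isOutcome tie b τ.2 && satisfies (value (A a)) τ.1 :=
    any hT (and (polyTime_isOutcome tie b snd.snd') (polyTime_satisfies (hA.comp fst) snd.fst'))
  have h2 : PolyTime fun a => localSearch (unaryOfBits (k a).bits) (choices s (E a)) (A a) :=
    polyTime_localSearch (unary hk hkb) hT hA (fun a => widthLE_choices s (hw a) (hw1 a))
      (by simpa only [length_unaryOfBits] using hpow)
  exact and h1 (any (f := fun _ (q : SearchState) => isOutcome tie (!b) q.1.2 &&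
    satisfies (value q.2) q.1.1) h2 (and (polyTime_isOutcome tie (!b) snd.fst'.snd')
      (polyTime_satisfies snd.snd' snd.fst'.fst')))

end PolyTime

/-! ## Correctness -/

/-- The class of the first rule that applies to an example. -/
def firstClass {F : Type} (R : List (Term F × Bool)) (e : Example F) : Option Bool :=
  (R.find? fun r => decide (r.1.Applies e)).map Prod.snd

/-- The outcome of a majority vote with a convention for ties. -/
def voteOutcome (tie : Option Bool) (v : List Bool) : Option Bool :=
  if v.length / 2 + 1 ≤ v.count true then some true
  else if v.length / 2 + 1 ≤ v.count false then some false
  else tie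

theorem satisfies_ruleClauses {e : Example ℕ} {t : Term ℕ} {m : List (Term ℕ × Bool)} :
    satisfies e (ruleClauses t m) = true ↔ t.Applies e ∧ ∀ r ∈ m, ¬ r.1.Applies e := by
  simp only [satisfies, ruleClauses, List.all_append, List.all_map, Bool.and_eq_true,
    List.all_eq_true, Function.comp_apply, List.any_cons, List.any_nil, Bool.or_false, List.any_map,
    List.any_eq_true, holds, beq_iff_eq, Term.Applies, not_forall]
  refine and_congr Iff.rfl (forall₂_congr fun r _ => exists_congr fun l => ?_)
  rw [exists_prop]
  refine and_congr Iff.rfl ?_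
  cases e l.1 <;> cases l.2 <;> simp

/-- A non-empty tail of the reversed list is a rule followed by exactly the rules before it, nearest
first. -/
theorem mem_options {R : List (Term ℕ × Bool)} {o : List (List (Literal ℕ)) × Bool} :
    o ∈ options R ↔
      ∃ r l₁ l₂, R = l₁ ++ r :: l₂ ∧ o = (ruleClauses r.1 l₁.reverse, r.2) := by
  simp only [options, List.mem_flatMap, List.mem_tails]
  constructor
  · rintro ⟨_ | ⟨r, prev⟩, ⟨l, hl⟩, ho⟩
    · simp at ho
    · refine ⟨r, prev.reverse, l.reverse, ?_, by simpa using ho⟩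
      rw [← List.reverse_reverse R, ← hl]
      simp
  · rintro ⟨r, l₁, l₂, rfl, rfl⟩
    exact ⟨r :: l₁.reverse, ⟨l₂.reverse, by simp⟩, by simp⟩

theorem exists_option_iff {R : List (Term ℕ × Bool)} {e : Example ℕ} {c : Bool} :
    (∃ o ∈ options R, satisfies e o.1 = true ∧ o.2 = c) ↔ firstClass R e = some c := by
  simp only [firstClass, Option.map_eq_some_iff, List.find?_eq_some_iff_append, mem_options]
  constructor
  · rintro ⟨_, ⟨r, l₁, l₂, rfl, rfl⟩, hs, rfl⟩
    obtain ⟨h1, h2⟩ := satisfies_ruleClauses.1 hs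
    exact ⟨r, ⟨by simpa using h1, l₁, l₂, rfl, fun r' hr' => by
      simpa using h2 r' (List.mem_reverse.2 hr')⟩, rfl⟩
  · rintro ⟨r, ⟨h1, l₁, l₂, rfl, h2⟩, rfl⟩
    refine ⟨_, ⟨r, l₁, l₂, rfl, rfl⟩, satisfies_ruleClauses.2 ⟨by simpa using h1,
      fun r' hr' => ?_⟩, rfl⟩
    simpa using h2 r' (List.mem_reverse.1 hr')

theorem satisfies_append {e : Example ℕ} {C D : List (List (Literal ℕ))} :
    satisfies e (C ++ D) = true ↔ satisfies e C = true ∧ satisfies e D = true := by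
  rw [satisfies, List.all_append, Bool.and_eq_true]
  rfl

theorem exists_extend_iff {T : List Choice} {R : List (Term ℕ × Bool)} {e : Example ℕ} {c : Bool}
    (hc : firstClass R e = some c) {P : List Bool → Prop} :
    (∃ τ ∈ extend T R, satisfies e τ.1 = true ∧ P τ.2) ↔
      ∃ τ ∈ T, satisfies e τ.1 = true ∧ P (c :: τ.2) := by
  constructor
  · rintro ⟨τ, hτ, hs, hP⟩
    obtain ⟨ρ, hρ, hτ⟩ := List.mem_flatMap.1 hτ
    obtain ⟨o, ho, rfl⟩ := List.mem_map.1 hτ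
    obtain ⟨h1, h2⟩ := satisfies_append.1 hs
    have hoc := exists_option_iff.1 ⟨o, ho, h1, rfl⟩
    rw [hc, Option.some_inj] at hoc
    exact ⟨ρ, hρ, h2, hoc ▸ hP⟩
  · rintro ⟨τ, hτ, hs, hP⟩
    obtain ⟨o, ho, h1, rfl⟩ := exists_option_iff.2 hc
    exact ⟨_, List.mem_flatMap.2 ⟨τ, hτ, List.mem_map.2 ⟨o, ho, rfl⟩⟩,
      satisfies_append.2 ⟨h1, hs⟩, hP⟩

/-- An example satisfies the clauses of some choice, and all such choices carry the same classes
because the first applicable rule is unique. The classes are reversed since each new one is put in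
front; steps beyond the number of lists do nothing. -/
theorem exists_choice_iff {s : ℕ} {E : List (List (Term ℕ × Bool))} (hs : E.length ≤ s)
    {e : Example ℕ} {v : List Bool} (hv : E.map (firstClass · e) = v.map some)
    {P : List Bool → Prop} :
    (∃ τ ∈ choices s E, satisfies e τ.1 = true ∧ P τ.2) ↔ P v.reverse := by
  have key : ∀ (s : ℕ) (E : List (List (Term ℕ × Bool))) (T : List Choice) (v : List Bool),
      E.length ≤ s → E.map (firstClass · e) = v.map some →
      ((∃ τ ∈ (extendStep^[s] (E, T)).2, satisfies e τ.1 = true ∧ P τ.2) ↔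
        ∃ τ ∈ T, satisfies e τ.1 = true ∧ P (v.reverse ++ τ.2)) := by
    intro s
    induction s with
    | zero =>
      intro E T v hs hv
      obtain rfl := List.length_eq_zero_iff.1 (Nat.le_zero.1 hs)
      obtain rfl : v = [] := by simpa using hv.symm
      rfl
    | succ s ih =>
      rintro (_ | ⟨R, E⟩) T v hs hv
      · exact ih [] T v (Nat.zero_le _) hv
      · obtain _ | ⟨c, v⟩ := v
        · simp at hv
        · simp only [List.map_cons, List.cons.injEq] at hv
          refine (ih E (extend T R) v (Nat.le_of_succ_le_succ hs) hv.2).trans ?_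
          refine (exists_extend_iff (P := fun x => P (v.reverse ++ x)) hv.1).trans ?_
          simp
  refine (key s E [([], [])] v hs hv).trans ?_
  simp [satisfies]

/-- With two classes, an absolute majority is the same as having strictly more votes than the other
class; a tie-break in favour of `b` relaxes this to at least as many. -/
theorem isOutcome_iff {tie : Option Bool} {b : Bool} {v : List Bool} :
    isOutcome tie b v = true ↔ voteOutcome tie v = some b := by
  have hsum : v.count true + v.count false = v.length := by
    induction v with
    | nil => rfl
    | cons c v ih => cases c <;> simp <;> omega
  have hle : ∀ m l : List Bool, (l.drop m.length).isEmpty = true ↔ l.length ≤ m.length := by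
    intro m l
    rw [List.isEmpty_iff, List.drop_eq_nil_iff]
  have hout : isOutcome tie b v = true ↔
      if tie = some b then v.count (!b) ≤ v.count b else v.count (!b) < v.count b := by
    simp only [isOutcome, decide_eq_true_eq, List.count_eq_length_filter]
    split_ifs
    · exact hle _ _
    · rw [Bool.not_eq_true', ← Bool.not_eq_true, hle, not_le]
  rw [hout, voteOutcome, ← hsum]
  clear hout hsum
  rcases tie with _ | _ | _ <;> cases b <;> simp only [Bool.not_true, Bool.not_false] <;> grind

theorem exists_outcome_iff {s : ℕ} {E : List (List (Term ℕ × Bool))} (hs : E.length ≤ s)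
    {e : Example ℕ} {v : List Bool} (hv : E.map (firstClass · e) = v.map some)
    {tie : Option Bool} {b : Bool} :
    (∃ τ ∈ choices s E, satisfies e τ.1 = true ∧ isOutcome tie b τ.2 = true) ↔
      voteOutcome tie v = some b := by
  rw [exists_choice_iff (P := fun x => isOutcome tie b x = true) hs hv, isOutcome_iff, voteOutcome,
    voteOutcome, List.length_reverse, List.count_reverse, List.count_reverse]

/-! ### Correctness of the local search -/

theorem value_cons (l : Literal ℕ) (A : List (Literal ℕ)) (f : ℕ) :
    value (l :: A) f = if l.1 = f then l.2 else value A f := by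
  simp only [value, List.foldr_cons, decide_eq_true_eq]

theorem expand_eq_of_satisfies {q : SearchState} (h : satisfies (value q.2) q.1.1 = true) :
    expand q = [q] := by
  have : q.1.1.filter (fun c => !c.any (holds (value q.2))) = [] := by
    rw [List.filter_eq_nil_iff]
    intro c hc
    simp [List.all_eq_true.1 h c hc]
  simp [expand, this]

/-- A violated clause has a literal that a given solution satisfies; making it true gets closer to
the solution. -/
theorem exists_mem_expand {q : SearchState} {e : Example ℕ} (he : satisfies e q.1.1 = true)
    (h : satisfies (value q.2) q.1.1 ≠ true) {D : Finset ℕ} (hD : ∀ f ∉ D, value q.2 f = e f) :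
    ∃ q' ∈ expand q, q'.1 = q.1 ∧ ∃ f ∈ D, ∀ g ∉ D.erase f, value q'.2 g = e g := by
  have hne : q.1.1.filter (fun c => !c.any (holds (value q.2))) ≠ [] := by
    intro h0
    rw [List.filter_eq_nil_iff] at h0
    exact h (List.all_eq_true.2 fun c hc => by
      simpa only [Bool.not_eq_true', Bool.not_eq_false] using h0 c hc)
  obtain ⟨c, m, hcm⟩ := List.exists_cons_of_ne_nil hne
  obtain ⟨hc, hviol⟩ := List.mem_filter.1 (hcm ▸ List.mem_cons_self : c ∈ List.filter _ q.1.1)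
  obtain ⟨l, hl, hle⟩ := List.any_eq_true.1 (List.all_eq_true.1 he c hc)
  have hle : e l.1 = l.2 := by simpa [holds] using hle
  have hlq : value q.2 l.1 ≠ l.2 := fun h0 => by
    rw [Bool.not_eq_true', List.any_eq_false] at hviol
    exact hviol l hl (by simpa [holds] using h0)
  refine ⟨(q.1, l :: q.2), ?_, rfl, l.1, ?_, fun g hg => ?_⟩
  · simp only [expand, hcm]
    exact List.mem_map.2 ⟨l, hl, rfl⟩
  · by_contra hlD
    exact hlq ((hD _ hlD).trans hle)
  · rw [value_cons]
    split_ifs with hgl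
    · rw [← hgl, hle]
    · exact hD g fun hgD => hg (Finset.mem_erase.2 ⟨Ne.symm hgl, hgD⟩)

/-- `D` contains all features where the current assignment differs from a solution. Some branch
removes a feature from it in each round until all clauses hold. -/
theorem exists_mem_foldl_expand (u : List Unit) {L : List SearchState} {q : SearchState}
    (hq : q ∈ L) {e : Example ℕ} (he : satisfies e q.1.1 = true) {D : Finset ℕ}
    (hDu : D.card ≤ u.length) (hD : ∀ f ∉ D, value q.2 f = e f) :
    ∃ q' ∈ u.foldl (fun L _ => L.flatMap expand) L,
      q'.1 = q.1 ∧ satisfies (value q'.2) q'.1.1 = true := by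
  induction u generalizing L q D e with
  | nil =>
    obtain rfl : D = ∅ := Finset.card_eq_zero.1 (Nat.le_zero.1 hDu)
    have : value q.2 = e := funext fun f => hD f (Finset.notMem_empty f)
    exact ⟨q, hq, rfl, this ▸ he⟩
  | cons a u ih =>
    by_cases h : satisfies (value q.2) q.1.1 = true
    · have hmem : q ∈ L.flatMap expand :=
        List.mem_flatMap.2 ⟨q, hq, by rw [expand_eq_of_satisfies h]; exact List.mem_cons_self⟩
      -- The state is kept from now on: its own assignment takes over the role of the solution `e`.
      exact ih (D := ∅) hmem h (Nat.zero_le _) fun _ _ => rfl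
    · obtain ⟨q', hq', h1, f, hf, hD'⟩ := exists_mem_expand he h hD
      have hcard : (D.erase f).card ≤ u.length := by
        rw [Finset.card_erase_of_mem hf]
        exact Nat.sub_le_of_le_add hDu
      obtain ⟨q'', hq'', h2, h3⟩ := ih (List.mem_flatMap.2 ⟨q, hq, hq'⟩) (by rwa [h1]) hcard hD'
      exact ⟨q'', hq'', h2.trans h1, h3⟩

theorem differs_of_mem_expand {q q' : SearchState} (h : q' ∈ expand q) :
    ∃ f, ∀ g ≠ f, value q'.2 g = value q.2 g := by
  unfold expand at h
  split at h
  · rw [List.mem_singleton.1 h]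
    -- Nothing changed, so any feature serves as the exception.
    exact ⟨0, fun _ _ => rfl⟩
  · obtain ⟨l, -, rfl⟩ := List.mem_map.1 h
    exact ⟨l.1, fun g hg => by rw [value_cons, if_neg hg.symm]⟩

theorem differs_of_mem_foldl_expand (u : List Unit) {L : List SearchState} {q' : SearchState}
    (h : q' ∈ u.foldl (fun L _ => L.flatMap expand) L) :
    ∃ q ∈ L, q'.1 = q.1 ∧ ∃ D : Finset ℕ, D.card ≤ u.length ∧
      ∀ f ∉ D, value q'.2 f = value q.2 f := by
  induction u generalizing L with
  | nil => exact ⟨q', h, rfl, ∅, le_refl _, fun _ _ => rfl⟩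
  | cons a u ih =>
    obtain ⟨p, hp, h1, D, hDu, hD⟩ := ih h
    obtain ⟨q, hq, hpq⟩ := List.mem_flatMap.1 hp
    obtain ⟨f, hf⟩ := differs_of_mem_expand hpq
    refine ⟨q, hq, h1.trans (fst_eq_of_mem_expand hpq), insert f D,
      (Finset.card_insert_le _ _).trans (Nat.succ_le_succ hDu), fun g hg => ?_⟩
    rw [Finset.mem_insert, not_or] at hg
    rw [hD g hg.2, hf g hg.1]

/-- Soundness: each round changes at most one feature. Completeness: the CNF of the guess realized
by `e` has `e` itself as a solution within distance `k`, so the search finds a solution, possibly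
another one, with the same outcome. -/
theorem flipsFrom_iff {s : ℕ} {tie : Option Bool} {E : List (List (Term ℕ × Bool))}
    (hs : E.length ≤ s) {v : Example ℕ → List Bool}
    (hv : ∀ e, E.map (firstClass · e) = (v e).map some) {A : List (Literal ℕ)} {k : ℕ} {b : Bool} :
    flipsFrom s tie E A k b = true ↔ voteOutcome tie (v (value A)) = some b ∧
      ∃ e : Example ℕ, (∃ D : Finset ℕ, D.card ≤ k ∧ ∀ f ∉ D, e f = value A f) ∧
        voteOutcome tie (v e) = some (!b) := by
  rw [flipsFrom, Bool.and_eq_true]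
  refine and_congr ?_ ?_
  · rw [← exists_outcome_iff hs (hv _), List.any_eq_true]
    simp only [Bool.and_eq_true, and_comm]
  · simp only [List.any_eq_true, Bool.and_eq_true, localSearch]
    constructor
    · rintro ⟨q, hq, h1, h2⟩
      obtain ⟨q₀, hq₀, h3, D, hD, h4⟩ := differs_of_mem_foldl_expand _ hq
      obtain ⟨τ, hτ, rfl⟩ := List.mem_map.1 hq₀
      rw [PolyTime.length_unaryOfBits] at hD
      exact ⟨value q.2, ⟨D, hD, h4⟩, (exists_outcome_iff hs (hv _)).1 ⟨τ, hτ, by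
        rw [h3] at h1 h2
        exact ⟨h2, h1⟩⟩⟩
    · rintro ⟨e, ⟨D, hD, h1⟩, h2⟩
      obtain ⟨τ, hτ, h3, h4⟩ := (exists_outcome_iff hs (hv _)).2 h2
      obtain ⟨q, hq, h5, h6⟩ := exists_mem_foldl_expand (PolyTime.unaryOfBits k.bits)
        (List.mem_map_of_mem (f := fun τ => (τ, A)) hτ) h3 (D := D)
        (by rwa [PolyTime.length_unaryOfBits]) fun f hf => (h1 f hf).symm
      exact ⟨q, hq, by rw [h5]; exact h4, h6⟩

/-! ## Model types whose models are turned into decision lists -/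

/-- The length is bounded by the size of the encoding. -/
def LenLE (α : Type) [Encoded α] : Prop := ∀ a : α, len a ≤ 2 * (enc a).size + 2

theorem LenLE.bool : LenLE Bool := fun b => by cases b <;> simp [len, enc, encodeBool]

theorem LenLE.prod {α β : Type} [Encoded α] [Encoded β] (hα : LenLE α) (hβ : LenLE β) :
    LenLE (α × β) := fun p => by
  have h1 := hα p.1
  have h2 := hβ p.2
  obtain ⟨a, b⟩ := p
  simp only [Data.size, enc_prod, len_prod, BinaryTree.numNodes] at *
  omega

theorem LenLE.list {α : Type} [Encoded α] (hα : LenLE α) : LenLE (List α) := fun l => by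
  induction l with
  | nil => simp
  | cons a l ih =>
    have h1 := hα a
    simp only [Data.size, enc_list_cons, len_list_cons, BinaryTree.numNodes] at *
    omega

theorem LenLE.nat : LenLE ℕ := fun n => LenLE.bool.list n.bits

/-- A literal, with its feature as a natural number. -/
def liftLiteral {n : ℕ} (l : Literal (Fin n)) : Literal ℕ := (l.1, l.2)

theorem enc_map {α β : Type} [Encoded β] {f : α → β} {g : α → Data} (h : ∀ a, enc (f a) = g a)
    (l : List α) : enc (l.map f) = encodeList g l := by
  induction l with
  | nil => rfl
  | cons a l ih => rw [List.map_cons, enc_list_cons, ih, h, encodeList]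

theorem enc_map_liftLiteral {n : ℕ} (t : Term (Fin n)) :
    enc (t.map liftLiteral) = encodeTerm t :=
  enc_map (fun _ => rfl) t

theorem applies_map_liftLiteral {n : ℕ} {t : Term (Fin n)} {e : Example ℕ} :
    Term.Applies (t.map liftLiteral) e ↔ t.Applies fun i => e i := by
  simp only [Term.Applies, List.forall_mem_map, liftLiteral]

/-- The literals that list the values of an example. -/
def exampleLiterals {n : ℕ} (e : Example (Fin n)) : List (Literal ℕ) :=
  (List.ofFn fun i => (i, e i)).map liftLiteral

theorem value_exampleLiterals {n : ℕ} (e : Example (Fin n)) (i : Fin n) :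
    value (exampleLiterals e) i = e i := by
  have key : ∀ l : List (Fin n), i ∈ l →
      value ((l.map fun j => (j, e j)).map liftLiteral) i = e i := by
    intro l
    induction l with
    | nil => simp
    | cons j l ih =>
      intro hi
      rw [List.map_cons, List.map_cons, value_cons]
      split_ifs with h
      · rw [show j = i from Fin.ext h]
        rfl
      · exact ih ((List.mem_cons.1 hi).resolve_left fun hij => h (by rw [hij]; rfl))
  have := key (List.finRange n) (List.mem_finRange i)
  rwa [← List.ofFn_eq_map] at this

/-- An example over the first `n` natural numbers, extended by an example over all of them. -/
def extendExample {n : ℕ} (e : Example (Fin n)) (d : Example ℕ) : Example ℕ := fun f =>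
  if h : f < n then e ⟨f, h⟩ else d f

/-- The search works on examples over all of `ℕ`. Features outside the instance do not influence the
votes: they are dropped from `D` in one direction and keep their starting values in the other. -/
theorem lCXpCard_yes_iff {𝓝 : ModelType} (x : LCXpInstance 𝓝) {tie : Option Bool}
    {v : Example (Fin x.numFeatures) → List Bool}
    (hv : ∀ e, 𝓝.classify x.model e = voteOutcome tie (v e)) {s : ℕ}
    {E : List (List (Term ℕ × Bool))} (hs : E.length ≤ s)
    (hE : ∀ e : Example ℕ, E.map (firstClass · e) = (v fun i => e i).map some) :
    (flipsFrom s tie E (exampleLiterals x.ex) x.bound true ||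
      flipsFrom s tie E (exampleLiterals x.ex) x.bound false) = true ↔ (lCXpCard 𝓝).Yes x := by
  have hex : (fun i : Fin x.numFeatures => value (exampleLiterals x.ex) i) = x.ex :=
    funext (value_exampleLiterals x.ex)
  have hb : (flipsFrom s tie E (exampleLiterals x.ex) x.bound true ||
      flipsFrom s tie E (exampleLiterals x.ex) x.bound false) = true ↔
      ∃ b, flipsFrom s tie E (exampleLiterals x.ex) x.bound b = true := by
    rw [Bool.or_eq_true, Bool.exists_bool, or_comm]
  rw [hb]
  simp only [flipsFrom_iff (v := fun e : Example ℕ => v fun i => e i) hs hE, hex]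
  constructor
  · rintro ⟨b, h1, e, ⟨D, hD, h2⟩, h3⟩
    refine ⟨Finset.univ.filter fun i : Fin x.numFeatures => (i : ℕ) ∈ D,
      (Finset.card_le_card_of_injOn Fin.val (fun i hi => ?_) Fin.val_injective.injOn).trans hD,
      fun i => e i, fun i hi => ?_, b, ?_, ?_⟩
    · simpa using hi
    · exact (h2 i (by simpa using hi)).trans (value_exampleLiterals x.ex i)
    · rw [hv, h1]
    · rw [hv, h3]
  · rintro ⟨A, hA, e, h1, b, h2, h3⟩
    have he : (fun i : Fin x.numFeatures =>
        extendExample e (value (exampleLiterals x.ex)) i) = e :=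
      funext fun i => by simp [extendExample]
    refine ⟨b, by rw [← hv, h2], extendExample e (value (exampleLiterals x.ex)),
      ⟨A.map Fin.valEmbedding, by rwa [Finset.card_map], fun f hf => ?_⟩, by
        rw [he, ← hv, h3]⟩
    unfold extendExample
    split_ifs with hfn
    · rw [h1 ⟨f, hfn⟩ fun h => hf (Finset.mem_map.2 ⟨_, h, rfl⟩)]
      exact (value_exampleLiterals x.ex ⟨f, hfn⟩).symm
    · rfl

/-- Instances get the length of their raw data plus `pad` of the parameter. Polynomial time in this
length is a bound `(len + pad) ^ c`, which splits into a function of the parameter times a power of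
the size of the encoding. -/
theorem isFPT_of_decisionLists {𝓝 : ModelType} {R : Type} [Encoded R] (hR : LenLE R)
    (code : ∀ {n}, 𝓝.Model n → R) (hcode : ∀ {n} (M : 𝓝.Model n), enc (code M) = 𝓝.encode M)
    {toLists : R → List (List (Term ℕ × Bool))} (hlists : PolyTime toLists)
    (s : ℕ) (hs : ∀ {n} (M : 𝓝.Model n), (toLists (code M)).length ≤ s) (tie : Option Bool)
    (v : ∀ {n}, 𝓝.Model n → Example (Fin n) → List Bool)
    (hv : ∀ {n} (M : 𝓝.Model n) e, 𝓝.classify M e = voteOutcome tie (v M e))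
    (hclass : ∀ {n} (M : 𝓝.Model n) (e : Example ℕ),
      (toLists (code M)).map (firstClass · e) = (v M fun i => e i).map some)
    (hsize : ∀ {n} (M : 𝓝.Model n), ∀ L ∈ toLists (code M), ∀ r ∈ L,
      r.1.length ≤ 𝓝.termSize M) :
    (lCXpCard 𝓝).IsFPT := by
  let raw : LCXpInstance 𝓝 → R × List (Literal ℕ) × ℕ := fun x =>
    (code x.model, exampleLiterals x.ex, x.bound)
  -- Dominates `(2 * (w + 1)) ^ k` for the width bound `w = κ + 1`, which is positive even when all
  -- terms are empty, and for `k ≤ κ`.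
  let pad : ℕ → ℕ := fun κ => (2 * (κ + 2)) ^ κ
  have henc : ∀ x, enc (raw x) = x.encode := fun x => by
    simp only [raw, enc_prod, hcode, exampleLiterals, enc_map_liftLiteral]
    rfl
  let inst : Encoded (LCXpInstance 𝓝) :=
    { enc := LCXpInstance.encode
      len := fun x => len (raw x) + pad ((lCXpCard 𝓝).param x)
      size_add_two_le := fun x => by
        rw [← henc]
        exact (size_add_two_le (raw x)).trans (Nat.le_add_right _ _) }
  have hraw : PolyTime raw :=
    PolyTime.of_enc_eq henc (PolyBdd.len_self.mono fun x => Nat.le_add_right _ _)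
  have hpow : PolyBdd fun x : LCXpInstance 𝓝 =>
      (2 * ((lCXpCard 𝓝).param x + 1 + 1)) ^ x.bound :=
    PolyBdd.len_self.mono fun x =>
      (Nat.pow_le_pow_right (by omega) (Nat.le_add_left _ _)).trans (Nat.le_add_left _ _)
  have hflip : ∀ b, PolyTime fun x : LCXpInstance 𝓝 =>
      flipsFrom s tie (toLists (code x.model)) (exampleLiterals x.ex) x.bound b := fun b =>
    polyTime_flipsFrom s tie (hlists.comp hraw.fst') hraw.snd'.fst' hraw.snd'.snd'
      (w := fun x => (lCXpCard 𝓝).param x + 1)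
      (fun x L hL r hr => (hsize x.model L hL r hr).trans
        ((Nat.le_add_right _ _).trans (Nat.le_succ _))) (fun x => Nat.le_add_left _ _) hpow b
  obtain ⟨p, T, ⟨c, hT⟩, -, hp⟩ := (hflip true).or (hflip false)
  refine ⟨p, fun κ => (pad κ + 4) ^ c, c, ?_, fun x : LCXpInstance 𝓝 => ?_⟩
  · have hpow' : Primrec₂ ((· ^ ·) : ℕ → ℕ → ℕ) := Primrec₂.unpaired'.1 Nat.Primrec.pow
    have hpad : Primrec pad := hpow'.comp
      (Primrec.nat_mul.comp (Primrec.const 2) (Primrec.nat_add.comp Primrec.id (Primrec.const 2)))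
      Primrec.id
    exact (hpow'.comp (Primrec.nat_add.comp hpad (Primrec.const 4)) (Primrec.const c)).to_comp
  · obtain ⟨t, ht, hrun⟩ := hp x
    refine ⟨_, t, hrun, (ht.trans (hT x)).trans ?_, ?_⟩
    · rw [← mul_pow]
      -- The raw length is at most twice the size `n` of the encoding plus 2, and `n ≥ 1`; hence the
      -- sum with `pad` is at most `(pad + 4) * n`.
      refine Nat.pow_le_pow_left ?_ c
      have h1 : len x = len (raw x) + pad ((lCXpCard 𝓝).param x) := rfl
      have h2 := hR.prod ((LenLE.nat.prod LenLE.bool).list.prod LenLE.nat) (raw x)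
      rw [henc x] at h2
      have h3 : 1 ≤ x.encode.size := Nat.le_add_left 1 _
      change len x ≤ (pad ((lCXpCard 𝓝).param x) + 4) * x.encode.size
      nlinarith
    · rw [← lCXpCard_yes_iff x (hv x.model) (hs x.model) (hclass x.model)]
      beta_reduce
      generalize (flipsFrom s tie _ _ x.bound true || _) = b
      cases b <;> simp [enc, encodeBool]

theorem voteOutcome_singleton (b : Bool) : voteOutcome none [b] = some b := by
  cases b <;> rfl

theorem majority_eq_voteOutcome {𝓜 : ModelType} {n : ℕ}
    {c : 𝓜.Model n → Example (Fin n) → Bool} (hc : ∀ M e, 𝓜.classify M e = some (c M e))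
    (tie : Option Bool) (E : List (𝓜.Model n)) (e : Example (Fin n)) :
    𝓜.majority tie E e = voteOutcome tie (E.map fun M => c M e) := by
  have : ∀ b, 𝓜.votes E e b = (E.map fun M => c M e).count b := fun b => by
    simp only [ModelType.votes, hc, Option.some_inj, List.count, List.countP_map]
    rfl
  simp only [ModelType.majority, voteOutcome, this, List.length_map]

theorem le_foldr_max {l : List ℕ} {a : ℕ} (h : a ∈ l) : a ≤ l.foldr max 0 := by
  induction l with
  | nil => simp at h
  | cons b l ih =>
    rcases List.mem_cons.1 h with rfl | h
    · exact le_max_left _ _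
    · exact (ih h).trans (le_max_right _ _)

theorem isFPT_and_ensembles_isFPT {𝓜 : ModelType} {R : Type} [Encoded R] (hR : LenLE R)
    (code : ∀ {n}, 𝓜.Model n → R) (hcode : ∀ {n} (M : 𝓜.Model n), enc (code M) = 𝓜.encode M)
    {toList : R → List (Term ℕ × Bool)} (hlist : PolyTime toList)
    (c : ∀ {n}, 𝓜.Model n → Example (Fin n) → Bool)
    (hc : ∀ {n} (M : 𝓜.Model n) e, 𝓜.classify M e = some (c M e))
    (hclass : ∀ {n} (M : 𝓜.Model n) (e : Example ℕ),
      firstClass (toList (code M)) e = some (c M fun i => e i))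
    (hsize : ∀ {n} (M : 𝓜.Model n), ∀ r ∈ toList (code M), r.1.length ≤ 𝓜.termSize M) :
    (lCXpCard 𝓜).IsFPT ∧
      ∀ (s : ℕ) (tie : Option Bool), (lCXpCard (𝓜.ensembles s tie)).IsFPT := by
  refine ⟨isFPT_of_decisionLists hR code hcode (toLists := fun r => [toList r])
      (hlist.cons (.const [])) 1 (fun _ => le_refl 1) none (fun M e => [c M e])
      (fun M e => by rw [voteOutcome_singleton, hc]) (fun M e => by simp [hclass])
      (fun M L hL => by rw [List.mem_singleton.1 hL]; exact hsize M), fun s tie =>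
    isFPT_of_decisionLists (𝓝 := 𝓜.ensembles s tie) hR.list (fun E => E.val.map code)
      (fun E => enc_map hcode E.val) (toLists := fun l => l.map toList)
      (PolyTime.map (f := fun _ r => toList r) PolyTime.id (hlist.comp .snd)) s
      (fun E => by simpa using E.property) tie (fun E e => E.val.map fun M => c M e)
      (fun E e => majority_eq_voteOutcome hc tie E.val e) (fun E e => by simp [hclass])
      (fun E L hL r hr => ?_)⟩
  simp only [List.map_map, List.mem_map, Function.comp_apply] at hL
  obtain ⟨M, hM, rfl⟩ := hL
  exact (hsize M r hr).trans (le_foldr_max (List.mem_map_of_mem hM))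

theorem length_le_maxTermSize {F : Type} {ts : List (Term F)} {t : Term F} (h : t ∈ ts) :
    t.length ≤ maxTermSize ts :=
  le_foldr_max (List.mem_map_of_mem h)

/-! ## Decision sets and decision lists -/

theorem decisionLists_isFPT : (lCXpCard decisionLists).IsFPT ∧
    ∀ (s : ℕ) (tie : Option Bool), (lCXpCard (decisionLists.ensembles s tie)).IsFPT := by
  refine isFPT_and_ensembles_isFPT (R := List (Term ℕ × Bool))
    ((LenLE.nat.prod LenLE.bool).list.prod LenLE.bool).list
    (fun {n} (L : DecisionList (Fin n)) => L.rules.map fun r => (r.1.map liftLiteral, r.2))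
    (fun L => enc_map (fun r => ?_) _) PolyTime.id (fun L => L.classify) (fun _ _ => rfl)
    (fun {n} (L : DecisionList (Fin n)) e => ?_) (fun {n} (L : DecisionList (Fin n)) r hr => ?_)
  · rw [enc_prod, enc_map_liftLiteral]
    rfl
  · obtain ⟨c, hc⟩ := L.last_empty
    -- The final empty term applies to every example, so the default value in
    -- `DecisionList.classify` never matters.
    have hfind : (L.rules.find? fun r => decide (r.1.Applies fun i => e i)).isSome := by
      rw [List.find?_isSome]
      exact ⟨_, List.mem_of_getLast? hc, by simp [Term.Applies]⟩
    obtain ⟨r, hr⟩ := Option.isSome_iff_exists.1 hfind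
    simp only [firstClass, DecisionList.classify, List.find?_map, Function.comp_def,
      applies_map_liftLiteral, hr, Option.map_some, Option.getD_some]
  · obtain ⟨r', hr', rfl⟩ := List.mem_map.1 hr
    rw [List.length_map]
    exact length_le_maxTermSize (List.mem_map_of_mem hr')

theorem decisionSets_isFPT : (lCXpCard decisionSets).IsFPT ∧
    ∀ (s : ℕ) (tie : Option Bool), (lCXpCard (decisionSets.ensembles s tie)).IsFPT := by
  refine isFPT_and_ensembles_isFPT (R := List (Term ℕ) × Bool)
    ((LenLE.nat.prod LenLE.bool).list.list.prod LenLE.bool)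
    (fun {n} (S : DecisionSet (Fin n)) => (S.terms.map (List.map liftLiteral), S.default))
    -- All terms lead to the non-default class, so which one applies first is irrelevant; the
    -- closing empty term yields the default.
    (fun S => ?_) (toList := fun S => (S.1.map fun t => (t, !S.2)) ++ [([], S.2)])
    (.append (.map (f := fun S t => (t, !S.2)) .fst (.pair .snd (PolyTime.fst.snd').not))
      (.cons (.pair (.const []) .snd) (.const []))) (fun S => S.classify) (fun _ _ => rfl)
    (fun {n} (S : DecisionSet (Fin n)) e => ?_) (fun {n} (S : DecisionSet (Fin n)) r hr => ?_)
  · rw [enc_prod, enc_map enc_map_liftLiteral]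
    rfl
  · simp only [firstClass, DecisionSet.classify, List.map_map, List.find?_append, List.find?_map,
      Function.comp_def, applies_map_liftLiteral]
    cases h : S.terms.find? fun t => decide (t.Applies fun i => e i) with
    | none =>
      rw [if_neg]
      · simp [Term.Applies]
      · simpa using h
    | some t =>
      rw [if_pos]
      · rfl
      · exact ⟨t, List.mem_of_find?_eq_some h, by simpa using List.find?_some h⟩
  · rcases List.mem_append.1 hr with hr | hr
    · simp only [List.map_map, List.mem_map, Function.comp_apply] at hr
      obtain ⟨t, ht, rfl⟩ := hr
      rw [List.length_map]
      exact length_le_maxTermSize ht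
    · rw [List.mem_singleton.1 hr]
      exact Nat.zero_le _

theorem mainTheorem5 (𝓜 : ModelType) (h𝓜 : 𝓜 = decisionSets ∨ 𝓜 = decisionLists) :
    (lCXpCard 𝓜).IsFPT ∧
      ∀ (s : ℕ) (tie : Option Bool), (lCXpCard (𝓜.ensembles s tie)).IsFPT := by
  rcases h𝓜 with rfl | rfl
  · exact decisionSets_isFPT
  · exact decisionLists_isFPT
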